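/- **Theorem (Synchronous Byzantine $\mu^2$-SGD).** Setting. Let $\mathcal K\subseteq\mathbb R^d$ be compact and convex with $\|\mathbf x-\mathbf y\|\le D$ for all $\mathbf x,\mathbf y\in\mathcal K$. There are $m\ge 1$ workers; those in $\mathcal G\subseteq[m]$ are honest, where $|\mathcal G|\ge(1-\delta)m$ and $0\le\delta<1/2$. Put $f_i(\mathbf x)=\mathbb E_{\mathbf z\sim\mathcal D^{(i)}}f_i(\mathbf x;\mathbf z)$ for $i\in\mathcal G$ and $f=\frac1{|\mathcal G|}\sum_{i\in\mathcal G}f_i$, and let $f$ be convex on $\mathcal K$. Let $L>0$ and $\sigma,\sigma_L,\xi\ge0$ be such that, for all $i\in\mathcal G$ and $\mathbf x,\mathbf y\in\mathcal K$, - $\|\nabla f_i(\mathbf x;\mathbf z)-\nabla f_i(\mathbf y;\mathbf z)\|\le L\|\mathbf x-\mathbf y\|$ for almost every $\mathbf z\sim\mathcal D^{(i)}$ (one null set for all $\mathbf x,\mathbf y$); - $\mathbb E\|\nabla f_i(\mathbf x;\mathbf z)-\nabla f_i(\mathbf x)\|^2\le\sigma^2$, where $\nabla f_i(\mathbf x)=\mathbb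 E\,\nabla f_i(\mathbf x;\mathbf z)$; - $\mathbb E\|(\nabla f_i(\mathbf x;\mathbf z)-\nabla f_i(\mathbf x))-(\nabla f_i(\mathbf y;\mathbf z)-\nabla f_i(\mathbf y))\|^2\le\sigma_L^2\|\mathbf x-\mathbf y\|^2$; - $\frac1{|\mathcal G|}\sum_{j\in\mathcal G}\|\nabla f_j(\mathbf x)-\nabla f(\mathbf x)\|^2\le\xi^2$. Aggregation. Let $c_\delta\ge0$ and let $\mathcal A$ be a (possibly randomized) $(c_\delta,\delta)$-robust aggregation rule: for every $\mathcal G'\subseteq[m]$ with $|\mathcal G'|\ge(1-\delta)m$ and all random vectors $\mathbf v_1,\dots,\mathbf v_m\in\mathbb R^d$ with $(\mathbf v_i)_{i\in\mathcal G'}$ independent, if $\mathbb E\|\mathbf v_i-\bar{\mathbf v}\|^2\le\rho_i^2$ for $i\in\mathcal G'$, where $\bar{\mathbf v}=\frac1{|\mathcal G'|}\sum_{i\in\mathcal G'}\mathbf v_i$, then $\mathbb E\|\mathcal A(\mathbf v_1,\dots,\mathbf v_m)-\bar{\mathbf v}\|^2\le c_\delta\frac1{|\mathcal G'|}\sum_{i\in\mathcal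 G'}\rho_i^2$. Algorithm. Let $T\ge1$, $\eta>0$, $\alpha_t=t$, $\beta_t=1/t$ and $\mathbf w_1=\mathbf x_1\in\mathcal K$. In round $t$ each honest worker $i$ draws a fresh sample $\mathbf z^{(i)}_t\sim\mathcal D^{(i)}$ (independent of the past and of the other honest samples) and sends $$\mathbf d^{(i)}_1=\nabla f_i(\mathbf x_1;\mathbf z^{(i)}_1),\qquad \mathbf d^{(i)}_{t}=\nabla f_i(\mathbf x_{t};\mathbf z^{(i)}_{t})+(1-\beta_{t})\big(\mathbf d^{(i)}_{t-1}-\nabla f_i(\mathbf x_{t-1};\mathbf z^{(i)}_{t})\big)\quad(t\ge2).$$ The other workers send arbitrary random vectors depending on the past, on the honest samples and messages of the current round, and on extra randomness independent of future draws. The server sets, with $\Pi_{\mathcal K}$ the orthogonal projection onto $\mathcal K$, $$\mathbf w_{t+1}=\Pi_{\mathcal K}\big(\mathbf w_t-\eta\alpha_t\,\mathcal A(\mathbf d_t^{(1)},\dots,\mathbf d_t^{(m)})\big),\qquad \mathbf x_{t+1}=\frac{\sum_{k=1}^{t+1}\alpha_k\mathbf w_k}{\sum_{k=1}^{t+1}\alpha_k}.$$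 Claim. There is an absolute constant $C$ such that, whenever $0<\eta\le\frac1{4LT}$ and $\mathbf x^*\in\arg\min_{\mathcal K}f$, with $G^*=\|\nabla f(\mathbf x^*)\|$ and $\tilde\sigma^2=2\sigma^2+8D^2\sigma_L^2$, $$\mathbb E[f(\mathbf x_T)-f(\mathbf x^*)]\le C\Big(\frac{D^2}{\eta T^2}+\frac{G^*D}{T}+\frac{D\tilde\sigma}{\sqrt T}\sqrt{c_\delta+\tfrac1m}+\sqrt{c_\delta}\,D\xi\Big),$$ and, for the learning rate $\eta=\frac1{4LT}$, $$\mathbb E[f(\mathbf x_T)-f(\mathbf x^*)]\le C\Big(\frac{G^*D+LD^2}{T}+\frac{D\tilde\sigma}{\sqrt T}\sqrt{c_\delta+\tfrac1m}+\sqrt{c_\delta}\,D\xi\Big).$$ -/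

import Mathlib

open MeasureTheory ProbabilityTheory

noncomputable section

namespace ByzSGD

/-- `ℝᵈ` with the Euclidean norm. -/
abbrev Vec (d : ℕ) : Type := EuclideanSpace ℝ (Fin d)

/-- The average `|G|⁻¹ ∑_{i ∈ G} vᵢ` over the honest workers. -/
def honestMean {d m : ℕ} (G : Finset (Fin m)) (v : Fin m → Vec d) : Vec d :=
  (G.card : ℝ)⁻¹ • ∑ i ∈ G, v i

/-- `(c, δ)`-robustness of a (possibly randomized) aggregation rule `A`, a Markov kernel that sends
the `m` inputs to the law of the output (a deterministic rule is `Kernel.deterministic`).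
The `m` random vectors enter through their joint law `P` on `(ℝᵈ)ᵐ`. -/
def IsRobust {d m : ℕ} (A : Kernel (Fin m → Vec d) (Vec d)) (c δ : ℝ) : Prop :=
  ∀ G : Finset (Fin m), (1 - δ) * (m : ℝ) ≤ (G.card : ℝ) →
  ∀ P : Measure (Fin m → Vec d), IsProbabilityMeasure P →
    iIndepFun (fun (i : G) (v : Fin m → Vec d) => v i) P →
  ∀ ρ : Fin m → ℝ, (∀ i ∈ G, 0 ≤ ρ i) →
    (∀ i ∈ G, ∫⁻ v, ‖v i - honestMean G v‖ₑ ^ 2 ∂P ≤ ENNReal.ofReal (ρ i ^ 2)) →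
    ∫⁻ v, ∫⁻ y, ‖y - honestMean G v‖ₑ ^ 2 ∂(A v) ∂P
      ≤ ENNReal.ofReal (c * ((G.card : ℝ)⁻¹ * ∑ i ∈ G, ρ i ^ 2))

/-- `p` is the orthogonal projection of `v` onto `K`. -/
def IsProj {d : ℕ} (K : Set (Vec d)) (v p : Vec d) : Prop :=
  p ∈ K ∧ IsMinOn (fun y => ‖y - v‖ ^ 2) K p

section Objective

variable {d m : ℕ} {Z : Type*} [MeasurableSpace Z]

/-- The objective `fᵢ(x) = 𝔼_{z ∼ 𝒟ᵢ} fᵢ(x; z)` of worker `i`. -/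
def localObj (𝒟 : Fin m → Measure Z) (loss : Fin m → Vec d → Z → ℝ) (i : Fin m) (x : Vec d) : ℝ :=
  ∫ z, loss i x z ∂(𝒟 i)

/-- The joint objective `f = |G|⁻¹ ∑_{i ∈ G} fᵢ`. -/
def objective (G : Finset (Fin m)) (𝒟 : Fin m → Measure Z) (loss : Fin m → Vec d → Z → ℝ)
    (x : Vec d) : ℝ :=
  (G.card : ℝ)⁻¹ * ∑ i ∈ G, localObj 𝒟 loss i x

/-- The gradient `∇fᵢ(x) = 𝔼_{z ∼ 𝒟ᵢ} ∇fᵢ(x; z)`; that it is a gradient of `fᵢ` on `K` is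
`hasGradientWithinAt_localObj` below. -/
def localGrad (𝒟 : Fin m → Measure Z) (grad : Fin m → Vec d → Z → Vec d) (i : Fin m)
    (x : Vec d) : Vec d :=
  ∫ z, grad i x z ∂(𝒟 i)

/-- The gradient `∇f = |G|⁻¹ ∑_{i ∈ G} ∇fᵢ` of the joint objective. -/
def objGrad (G : Finset (Fin m)) (𝒟 : Fin m → Measure Z) (grad : Fin m → Vec d → Z → Vec d)
    (x : Vec d) : Vec d :=
  honestMean G (fun i => localGrad 𝒟 grad i x)

/-- Stochastic smooth losses on `K`, with constants `L` (smoothness of almost every sample loss),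
`σ` (bounded variance), `σL` (bounded smoothness variance) and `ξ` (heterogeneity).
`grad i x z` is the gradient `∇fᵢ(x; z)` of `fᵢ(·; z) : K → ℝ`. The second moments are taken in
`[0, ∞]`, so that the bounds include their finiteness. -/
structure SmoothStochasticLosses (K : Set (Vec d)) (G : Finset (Fin m)) (𝒟 : Fin m → Measure Z)
    (loss : Fin m → Vec d → Z → ℝ) (grad : Fin m → Vec d → Z → Vec d)
    (L σ σL ξ : ℝ) : Prop where
  integrable_loss : ∀ i ∈ G, ∀ x ∈ K, Integrable (loss i x) (𝒟 i)
  measurable_grad : ∀ i ∈ G, ∀ x ∈ K, Measurable (grad i x)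
  hasGradient : ∀ i ∈ G, ∀ᵐ z ∂(𝒟 i), ∀ x ∈ K,
    HasGradientWithinAt (fun y => loss i y z) (grad i x z) K x
  smooth : ∀ i ∈ G, ∀ᵐ z ∂(𝒟 i), ∀ x ∈ K, ∀ y ∈ K,
    ‖grad i x z - grad i y z‖ ≤ L * ‖x - y‖
  variance : ∀ i ∈ G, ∀ x ∈ K,
    ∫⁻ z, ‖grad i x z - localGrad 𝒟 grad i x‖ₑ ^ 2 ∂(𝒟 i) ≤ ENNReal.ofReal (σ ^ 2)
  smoothVariance : ∀ i ∈ G, ∀ x ∈ K, ∀ y ∈ K,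
    ∫⁻ z, ‖(grad i x z - localGrad 𝒟 grad i x) - (grad i y z - localGrad 𝒟 grad i y)‖ₑ ^ 2 ∂(𝒟 i)
      ≤ ENNReal.ofReal (σL ^ 2 * ‖x - y‖ ^ 2)
  heterogeneity : ∀ x ∈ K,
    (G.card : ℝ)⁻¹ * ∑ i ∈ G, ‖localGrad 𝒟 grad i x - objGrad G 𝒟 grad x‖ ^ 2 ≤ ξ ^ 2

theorem SmoothStochasticLosses.integrable_grad {K : Set (Vec d)} {G : Finset (Fin m)}
    {𝒟 : Fin m → Measure Z} [∀ i, IsProbabilityMeasure (𝒟 i)]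
    {loss : Fin m → Vec d → Z → ℝ} {grad : Fin m → Vec d → Z → Vec d} {L σ σL ξ : ℝ}
    (h : SmoothStochasticLosses K G 𝒟 loss grad L σ σL ξ) {i : Fin m} (hi : i ∈ G)
    {x : Vec d} (hx : x ∈ K) : Integrable (grad i x) (𝒟 i) := by
  have hm := h.measurable_grad i hi x hx
  have h2 : MemLp (fun z => grad i x z - localGrad 𝒟 grad i x) 2 (𝒟 i) := by
    refine ⟨(hm.sub_const _).aestronglyMeasurable, ?_⟩
    rw [eLpNorm_lt_top_iff_lintegral_rpow_enorm_lt_top (by norm_num) (by norm_num)]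
    have := (h.variance i hi x hx).trans_lt ENNReal.ofReal_lt_top
    simpa using this
  have h1 := (h2.integrable (by norm_num)).add
    (integrable_const (μ := 𝒟 i) (localGrad 𝒟 grad i x))
  refine h1.congr (Filter.Eventually.of_forall fun z => ?_)
  simp

/-- Differentiation under the expectation: `localGrad` is a gradient of `localObj` on `K`. -/
theorem hasGradientWithinAt_localObj {K : Set (Vec d)} (hK : Convex ℝ K) {G : Finset (Fin m)}
    {𝒟 : Fin m → Measure Z} [∀ i, IsProbabilityMeasure (𝒟 i)]
    {loss : Fin m → Vec d → Z → ℝ} {grad : Fin m → Vec d → Z → Vec d} {L σ σL ξ : ℝ} (hL : 0 ≤ L)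
    (h : SmoothStochasticLosses K G 𝒟 loss grad L σ σL ξ) {i : Fin m} (hi : i ∈ G)
    {x : Vec d} (hx : x ∈ K) :
    HasGradientWithinAt (localObj 𝒟 loss i) (localGrad 𝒟 grad i x) K x := by
  have hgi := h.integrable_grad hi hx
  have key : ∀ y ∈ K, ‖localObj 𝒟 loss i y - localObj 𝒟 loss i x
      - inner ℝ (localGrad 𝒟 grad i x) (y - x)‖ ≤ L * ‖y - x‖ ^ 2 := by
    intro y hy
    have e : localObj 𝒟 loss i y - localObj 𝒟 loss i x - inner ℝ (localGrad 𝒟 grad i x) (y - x)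
        = ∫ z, (loss i y z - loss i x z - inner ℝ (grad i x z) (y - x)) ∂(𝒟 i) := by
      have h3 : Integrable (fun z => inner ℝ (grad i x z) (y - x)) (𝒟 i) :=
        hgi.inner_const (y - x)
      have h4 : ∫ z, (loss i y z - loss i x z - inner ℝ (grad i x z) (y - x)) ∂(𝒟 i)
          = ∫ z, (loss i y z - loss i x z) ∂(𝒟 i) - ∫ z, inner ℝ (grad i x z) (y - x) ∂(𝒟 i) :=
        integral_sub ((h.integrable_loss i hi y hy).sub (h.integrable_loss i hi x hx)) h3
      rw [h4, integral_sub (h.integrable_loss i hi y hy) (h.integrable_loss i hi x hx)]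
      have : inner ℝ (localGrad 𝒟 grad i x) (y - x)
          = ∫ z, inner ℝ (grad i x z) (y - x) ∂(𝒟 i) := by
        rw [real_inner_comm]
        simp_rw [real_inner_comm (y - x)]
        exact (integral_inner hgi (y - x)).symm
      rw [this]; rfl
    rw [e]
    have hb : ∀ᵐ z ∂(𝒟 i), ‖loss i y z - loss i x z - inner ℝ (grad i x z) (y - x)‖
        ≤ L * ‖y - x‖ ^ 2 := by
      filter_upwards [h.hasGradient i hi, h.smooth i hi] with z hz1 hz2
      have hseg : segment ℝ x y ⊆ K := hK.segment_subset hx hy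
      have := (convex_segment x y).norm_image_sub_le_of_norm_hasFDerivWithin_le' (𝕜 := ℝ)
        (f := fun y => loss i y z) (C := L * ‖y - x‖)
        (f' := fun u => InnerProductSpace.toDual ℝ (Vec d) (grad i u z))
        (φ := InnerProductSpace.toDual ℝ (Vec d) (grad i x z))
        (fun u hu => ((hz1 u (hseg hu)).hasFDerivWithinAt).mono hseg)
        (fun u hu => by
          rw [← map_sub, LinearIsometryEquiv.norm_map]
          refine (hz2 u (hseg hu) x hx).trans ?_
          gcongr
          rw [← dist_eq_norm, ← dist_eq_norm]
          have := dist_add_dist_of_mem_segment hu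
          rw [dist_comm u x, dist_comm y x]
          linarith [dist_nonneg (x := u) (y := y)])
        (left_mem_segment ℝ x y) (right_mem_segment ℝ x y)
      rw [InnerProductSpace.toDual_apply_apply] at this
      refine this.trans_eq ?_
      ring
    simpa using norm_integral_le_of_norm_le_const hb
  rw [hasGradientWithinAt_iff_isLittleO]
  have hO : (fun y => localObj 𝒟 loss i y - localObj 𝒟 loss i x
      - inner ℝ (localGrad 𝒟 grad i x) (y - x)) =O[nhdsWithin x K] fun y => ‖y - x‖ ^ 2 := by
    refine Asymptotics.IsBigO.of_bound L ?_
    filter_upwards [self_mem_nhdsWithin] with y hy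
    simpa using key y hy
  refine hO.trans_isLittleO ?_
  have := (Asymptotics.isLittleO_pow_sub_sub (E' := Vec d) x (m := 2) (by norm_num))
  exact (this.mono nhdsWithin_le_nhds)

end Objective

/-- Given the information `𝓐`, the random vector `Y` has the conditional law `κ`. -/
def HasCondLaw {Ω : Type*} [MeasurableSpace Ω] {d : ℕ} (P : Measure Ω) (𝓐 : MeasurableSpace Ω)
    (Y : Ω → Vec d) (κ : Ω → Measure (Vec d)) : Prop :=
  ∀ S : Set Ω, MeasurableSet[𝓐] S → ∀ B : Set (Vec d), MeasurableSet B →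
    P (S ∩ Y ⁻¹' B) = ∫⁻ ω in S, κ ω B ∂P

/-- The random variables of a run, indexed by the round `t = 1, 2, …`:
iterates `w`, query points `x`, samples `z`, messages `msg` (the vectors `d_t⁽ⁱ⁾` received by the
server), outputs `agg` of the aggregation rule, together with the information `hist t` available
when round `t` begins and the information `info t` available once all messages of round `t` have
been sent. -/
structure Run (Ω Z : Type*) (d m : ℕ) where
  w : ℕ → Ω → Vec d
  x : ℕ → Ω → Vec d
  z : ℕ → Fin m → Ω → Z
  msg : ℕ → Fin m → Ω → Vec d
  agg : ℕ → Ω → Vec d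
  hist : ℕ → MeasurableSpace Ω
  info : ℕ → MeasurableSpace Ω

/-- `R` is a run of synchronous robust `μ²`-SGD with `T` steps, in which the workers outside `G` are
Byzantine: they send any random vectors that depend on the information available when they are sent
(all earlier rounds, all samples and all honest messages of the current round, extra randomness). -/
structure IsSyncRun {Ω Z : Type*} [MeasurableSpace Ω] [MeasurableSpace Z] {d m : ℕ}
    (P : Measure Ω) (K : Set (Vec d)) (G : Finset (Fin m)) (𝒟 : Fin m → Measure Z)
    (grad : Fin m → Vec d → Z → Vec d) (A : Kernel (Fin m → Vec d) (Vec d))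
    (α β : ℕ → ℝ) (η : ℝ) (T : ℕ) (x₁ : Vec d) (R : Run Ω Z d m) : Prop where
  /-- information only grows -/
  hist_le_info : ∀ t, R.hist t ≤ R.info t
  info_le_hist : ∀ t, R.info t ≤ R.hist (t + 1)
  hist_le : ∀ t, R.hist t ≤ ‹MeasurableSpace Ω›
  measurable_z : ∀ t, 1 ≤ t → t ≤ T → ∀ i ∈ G, Measurable[R.info t] (R.z t i)
  measurable_msg : ∀ t, 1 ≤ t → t ≤ T → ∀ i, Measurable[R.info t] (R.msg t i)
  measurable_agg : ∀ t, 1 ≤ t → t ≤ T → Measurable[R.hist (t + 1)] (R.agg t)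
  /-- the honest samples of round `t` are drawn from `∏ 𝒟ᵢ`, independently of the past -/
  law_z : ∀ t, 1 ≤ t → t ≤ T →
    P.map (fun ω (i : G) => R.z t i ω) = Measure.pi (fun i : G => 𝒟 i)
  indep_z : ∀ t, 1 ≤ t → t ≤ T →
    Indep (MeasurableSpace.comap (fun ω (i : G) => R.z t i ω) inferInstance) (R.hist t) P
  /-- initialization -/
  x_one : ∀ ω, R.x 1 ω = x₁
  w_one : ∀ ω, R.w 1 ω = R.x 1 ω
  /-- messages of the honest workers: corrected momentum -/
  msg_one : ∀ i ∈ G, ∀ ω, R.msg 1 i ω = grad i (R.x 1 ω) (R.z 1 i ω)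
  msg_succ : ∀ t, 1 ≤ t → t < T → ∀ i ∈ G, ∀ ω,
    R.msg (t + 1) i ω = grad i (R.x (t + 1) ω) (R.z (t + 1) i ω)
      + (1 - β (t + 1)) • (R.msg t i ω - grad i (R.x t ω) (R.z (t + 1) i ω))
  /-- aggregation, with fresh randomness if `A` is randomized -/
  agg_law : ∀ t, 1 ≤ t → t ≤ T →
    HasCondLaw P (R.info t) (R.agg t) (fun ω => A (fun i => R.msg t i ω))
  /-- server update -/
  w_succ : ∀ t, 1 ≤ t → t ≤ T → ∀ ω,
    IsProj K (R.w t ω - (η * α t) • R.agg t ω) (R.w (t + 1) ω)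
  x_succ : ∀ t, 1 ≤ t → t ≤ T → ∀ ω,
    R.x (t + 1) ω = (∑ k ∈ Finset.Icc 1 (t + 1), α k)⁻¹
      • ∑ k ∈ Finset.Icc 1 (t + 1), α k • R.w k ω

end ByzSGD

end

namespace ByzSGD

/-! The argument separates a pathwise optimization bound from a second-moment bound on the server's
gradient error.

Pathwise (`weighted_average_bound`), with `a t` the aggregated vector, the potential `n(n+1)/2 ·
(f(x n) - f u) + (1 + 1/n)/(2η) · ‖w n - u‖²` grows in round `n` by at most `2LD² + (n+1) D ‖a n -
∇f(x n)‖`. Indeed `x (n+1) - x n = 2/(n+2) · (w (n+1) - x n)`; smoothness is used along this move,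
convexity at `x n`, and the projection inequality at `w (n+1)`. The accumulated `2LD²T` is absorbed
by `D²/η` because `η ≤ 1/(4LT)`.

For the error, `β t = 1/t` makes `t · (d t - ∇fᵢ(x t))` a martingale (`IsSyncRun.momentum_succ`).
Its increment is the fresh noise at the new point plus `t` times the difference of the noises at two
consecutive points. Since `t ‖x (t+1) - x t‖ ≤ 2D`, the increment has second moment at most `σ̃² =
2σ² + 8D²σL²`. Hence a worker's error has second moment at most `σ̃²/t`, and the honest average, by
independence across workers, at most `σ̃²/(t|G|)`.

Honest messages share the past and need not be independent, so robustness is used at Dirac laws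
(`IsRobust.lintegral_le`), where independence is free, and then integrated over the run. The spread
of the honest messages is at most their spread around `∇f(x t)`, that is, worker error plus
heterogeneity. Altogether the expected error is at most `2σ̃ √(c + 1/m)/√t + 2√c ξ`; weighting by `t
+ 1`, summing and dividing by `T²/2` gives the claim.

A technical layer makes the conditioning rigorous: gradients are measurable only in the sample, and
the Lipschitz property on `K` provides jointly measurable versions. -/

theorem nonpos_of_forall_le_mul {a b : ℝ} (h : ∀ s : ℝ, 0 < s → s ≤ 1 → a ≤ s * b) : a ≤ 0 := by
  by_contra! ha
  have hb : 0 < |b| + a := by positivity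
  -- This `s` gives `s * b ≤ a / 2 < a`; it replaces letting `s` tend to `0`.
  have h1 := h (a / (2 * (|b| + a))) (by positivity) (by
    rw [div_le_one (by positivity)]; linarith [abs_nonneg b])
  have h2 : a / (2 * (|b| + a)) * b ≤ a / (2 * (|b| + a)) * (|b| + a) := by
    gcongr; linarith [le_abs_self b]
  have h3 : a / (2 * (|b| + a)) * (|b| + a) = a / 2 := by field_simp
  linarith

/-! ### Orthogonal projection onto a convex set. -/

section Projection

variable {d : ℕ} {K : Set (Vec d)}

/-- First-order optimality: compare `p` with `p + s • (y - p)`, divide by `s` and let `s` tend to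
`0`. -/
theorem IsProj.inner_nonpos (hK : Convex ℝ K) {v p y : Vec d} (h : IsProj K v p) (hy : y ∈ K) :
    inner ℝ (v - p) (y - p) ≤ 0 := by
  have : 2 * inner ℝ (v - p) (y - p) ≤ 0 := by
    refine nonpos_of_forall_le_mul (b := ‖y - p‖ ^ 2) fun s hs hs1 => ?_
    have hm : p + s • (y - p) ∈ K := hK.add_smul_sub_mem h.1 hy ⟨hs.le, hs1⟩
    have h1 : ‖p - v‖ ^ 2 ≤ ‖p + s • (y - p) - v‖ ^ 2 := h.2 hm
    have h2 : p + s • (y - p) - v = s • (y - p) - (v - p) := by abel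
    rw [h2, norm_sub_sq_real (s • (y - p)), norm_sub_rev p v, norm_smul, real_inner_smul_left,
      real_inner_comm, mul_pow, Real.norm_eq_abs, sq_abs] at h1
    have h3 : s * (2 * inner ℝ (v - p) (y - p)) ≤ s * (s * ‖y - p‖ ^ 2) := by nlinarith
    exact le_of_mul_le_mul_left h3 hs
  linarith

/-- Add the two variational inequalities, each tested at the other projection, and apply
Cauchy–Schwarz. This yields both uniqueness and continuity of the projection. -/
theorem IsProj.norm_sub_le (hK : Convex ℝ K) {v v' p p' : Vec d} (h : IsProj K v p)
    (h' : IsProj K v' p') : ‖p - p'‖ ≤ ‖v - v'‖ := by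
  have h1 := h.inner_nonpos hK h'.1
  have h2 := h'.inner_nonpos hK h.1
  have h3 : inner ℝ (v - p) (p' - p) + inner ℝ (v' - p') (p - p')
      = ‖p - p'‖ ^ 2 - inner ℝ (v - v') (p - p') := by
    rw [← real_inner_self_eq_norm_sq]
    simp only [inner_sub_left, inner_sub_right]
    ring
  have h4 := real_inner_le_norm (v - v') (p - p')
  by_contra! hc
  nlinarith [norm_nonneg (v - v'), norm_nonneg (p - p')]

/-- Three-point identity, with the term `‖w - w'‖²` discarded. The regret is taken at the new point
`w'`, so no term in `‖g‖²` appears and no bound on the aggregated vectors is needed. -/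
theorem IsProj.regret (hK : Convex ℝ K) {w g w' u : Vec d} {γ : ℝ}
    (h : IsProj K (w - γ • g) w') (hu : u ∈ K) :
    γ * inner ℝ g (w' - u) ≤ (‖w - u‖ ^ 2 - ‖w' - u‖ ^ 2) / 2 := by
  have h1 := h.inner_nonpos hK hu
  have h2 : inner ℝ (w - γ • g - w') (u - w')
      = γ * inner ℝ g (w' - u) - inner ℝ (w - w') (w' - u) := by
    simp only [inner_sub_left, inner_sub_right, real_inner_smul_left]
    ring
  have h3 : w - u = (w - w') + (w' - u) := by abel
  have h4 := norm_add_sq_real (w - w') (w' - u)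
  rw [← h3] at h4
  nlinarith [sq_nonneg ‖w - w'‖]

theorem exists_isProj (hK : IsCompact K) (hne : K.Nonempty) (v : Vec d) : ∃ p, IsProj K v p :=
  hK.exists_isMinOn hne (by fun_prop)

/-- A continuous retraction onto a compact convex set that computes all orthogonal projections. -/
theorem exists_continuous_proj (hK : IsCompact K) (hc : Convex ℝ K) (hne : K.Nonempty) :
    ∃ π : Vec d → Vec d, Continuous π ∧ (∀ v, π v ∈ K) ∧ (∀ v ∈ K, π v = v) ∧
      ∀ v p, IsProj K v p → p = π v := by
  choose π hπ using exists_isProj hK hne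
  have huniq : ∀ v p, IsProj K v p → p = π v := fun v p hp => by
    have := hp.norm_sub_le hc (hπ v)
    simpa [sub_eq_zero] using this
  refine ⟨π, ?_, fun v => (hπ v).1, fun v hv => (huniq v v ⟨hv, fun y _ => ?_⟩).symm, huniq⟩
  · refine (LipschitzWith.of_dist_le_mul (K := 1) fun v v' => ?_).continuous
    simpa [dist_eq_norm] using (hπ v).norm_sub_le hc (hπ v')
  · simp

end Projection

/-! ### Pathwise convergence in terms of gradient errors. -/

section Descent

variable {d : ℕ} {K : Set (Vec d)} {f : Vec d → ℝ} {g : Vec d → Vec d} {L : ℝ}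

/-- Smoothness along segments of a convex set. -/
theorem abs_sub_sub_inner_le (hK : Convex ℝ K) (hL : 0 ≤ L)
    (hg : ∀ x ∈ K, HasGradientWithinAt f (g x) K x)
    (hlip : ∀ x ∈ K, ∀ y ∈ K, ‖g x - g y‖ ≤ L * ‖x - y‖) {x y : Vec d} (hx : x ∈ K) (hy : y ∈ K) :
    |f y - f x - inner ℝ (g x) (y - x)| ≤ L * ‖y - x‖ ^ 2 := by
  have hseg : segment ℝ x y ⊆ K := hK.segment_subset hx hy
  -- Mean value inequality for `f` minus its linearization at `x`; it gives the factor `L` instead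
  -- of the sharp `L / 2`, which only affects constants.
  have := (convex_segment x y).norm_image_sub_le_of_norm_hasFDerivWithin_le' (𝕜 := ℝ)
    (f := f) (C := L * ‖y - x‖)
    (f' := fun u => InnerProductSpace.toDual ℝ (Vec d) (g u))
    (φ := InnerProductSpace.toDual ℝ (Vec d) (g x))
    (fun u hu => ((hg u (hseg hu)).hasFDerivWithinAt).mono hseg)
    (fun u hu => by
      rw [← map_sub, LinearIsometryEquiv.norm_map]
      refine (hlip u (hseg hu) x hx).trans ?_
      gcongr
      rw [← dist_eq_norm, ← dist_eq_norm]
      have := dist_add_dist_of_mem_segment hu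
      rw [dist_comm u x, dist_comm y x]
      linarith [dist_nonneg (x := u) (y := y)])
    (left_mem_segment ℝ x y) (right_mem_segment ℝ x y)
  rw [InnerProductSpace.toDual_apply_apply, Real.norm_eq_abs] at this
  refine this.trans_eq ?_
  ring

/-- Convexity at `x + s • (y - x)` is linear in `s` while the quadratic error is of order `s²`;
divide by `s` and let it vanish. -/
theorem _root_.ConvexOn.inner_le_sub_of_quadratic (hf : ConvexOn ℝ K f)
    (hq : ∀ x ∈ K, ∀ y ∈ K, |f y - f x - inner ℝ (g x) (y - x)| ≤ L * ‖y - x‖ ^ 2)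
    {x y : Vec d} (hx : x ∈ K) (hy : y ∈ K) : inner ℝ (g x) (y - x) ≤ f y - f x := by
  have : inner ℝ (g x) (y - x) - (f y - f x) ≤ 0 := by
    refine nonpos_of_forall_le_mul (b := L * ‖y - x‖ ^ 2) fun s hs hs1 => ?_
    have hm : x + s • (y - x) ∈ K := hf.1.add_smul_sub_mem hx hy ⟨hs.le, hs1⟩
    have h1 := (abs_le.1 (hq x hx _ hm)).1
    have h2 := hf.2 hx hy (sub_nonneg.2 hs1) hs.le (by ring)
    have h3 : (1 - s) • x + s • y = x + s • (y - x) := by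
      rw [sub_smul, smul_sub, one_smul]; abel
    rw [h3] at h2
    rw [add_sub_cancel_left, real_inner_smul_right, norm_smul, Real.norm_eq_abs, mul_pow,
      sq_abs] at h1
    simp only [smul_eq_mul] at h2
    refine le_of_mul_le_mul_left (a := s) ?_ hs
    nlinarith
  linarith

theorem sum_Icc_natCast (n : ℕ) : ∑ k ∈ Finset.Icc 1 n, (k : ℝ) = n * (n + 1) / 2 := by
  induction n with
  | zero => simp
  | succ n ih =>
    rw [Finset.sum_Icc_succ_top (by omega), ih]
    push_cast
    ring

/-- The recursion of the query points: `x (n + 1)` is a convex combination of `x n`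
and `w (n + 1)`. -/
theorem average_succ {w x : ℕ → Vec d} {n : ℕ}
    (hx : x n = (∑ k ∈ Finset.Icc 1 n, (k : ℝ))⁻¹ • ∑ k ∈ Finset.Icc 1 n, (k : ℝ) • w k)
    (hn : 1 ≤ n)
    (hx' : x (n + 1) = (∑ k ∈ Finset.Icc 1 (n + 1), (k : ℝ))⁻¹
      • ∑ k ∈ Finset.Icc 1 (n + 1), (k : ℝ) • w k) :
    x (n + 1) = x n + (2 / ((n : ℝ) + 2)) • (w (n + 1) - x n) := by
  have hn' : (0 : ℝ) < n := by exact_mod_cast hn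
  rw [sum_Icc_natCast] at hx hx'
  rw [Finset.sum_Icc_succ_top (by omega)] at hx'
  set S := ∑ k ∈ Finset.Icc 1 n, (k : ℝ) • w k
  have hS : S = ((n : ℝ) * (n + 1) / 2) • x n := by
    rw [hx, smul_smul, mul_inv_cancel₀ (by positivity), one_smul]
  rw [hx', hS]
  push_cast
  rw [smul_add, smul_smul, smul_smul, smul_sub]
  have e1 : (((n : ℝ) + 1) * (n + 1 + 1) / 2)⁻¹ * ((n : ℝ) * (n + 1) / 2)
      = 1 - 2 / ((n : ℝ) + 2) := by field_simp; ring
  have e2 : (((n : ℝ) + 1) * (n + 1 + 1) / 2)⁻¹ * ((n : ℝ) + 1) = 2 / ((n : ℝ) + 2) := by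
    field_simp; ring
  rw [e1, e2, sub_smul, one_smul]
  abel

/-- Deterministic guarantee of projected gradient steps with linear weights taken at the weighted
averages of the iterates, in terms of the gradient errors. -/
theorem weighted_average_bound (hf : ConvexOn ℝ K f) (hL : 0 ≤ L)
    (hq : ∀ x ∈ K, ∀ y ∈ K, |f y - f x - inner ℝ (g x) (y - x)| ≤ L * ‖y - x‖ ^ 2)
    {D η : ℝ} (hD : ∀ x ∈ K, ∀ y ∈ K, ‖x - y‖ ≤ D) (hη : 0 < η)
    {T : ℕ} {w x a : ℕ → Vec d} (hw1 : w 1 = x 1) (hx1 : x 1 ∈ K)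
    (hxK : ∀ t, 1 ≤ t → t ≤ T → x t ∈ K)
    (hw : ∀ t, 1 ≤ t → t ≤ T → IsProj K (w t - (η * t) • a t) (w (t + 1)))
    (hx : ∀ t, 1 ≤ t → t < T → x (t + 1) = x t + (2 / ((t : ℝ) + 2)) • (w (t + 1) - x t))
    {u : Vec d} (hu : u ∈ K) {n : ℕ} (hn : 1 ≤ n) (hnT : n ≤ T) :
    (n * (n + 1) / 2 : ℝ) * (f (x n) - f u) + (1 + 1 / (n : ℝ)) / (2 * η) * ‖w n - u‖ ^ 2
      ≤ ‖g u‖ * D + D ^ 2 / η + 2 * L * D ^ 2 * n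
        + ∑ t ∈ Finset.Ico 1 n, ((t : ℝ) + 1) * (D * ‖a t - g (x t)‖) := by
  have hD0 : 0 ≤ D := (norm_nonneg _).trans (hD u hu u hu)
  induction n, hn using Nat.le_induction with
  | base =>
    -- The expansion is around `u`, not `x 1`: this is how the gradient norm at the minimizer
    -- enters, and only here.
    have h1 := (abs_le.1 (hq u hu _ hx1)).2
    have h2 : inner ℝ (g u) (x 1 - u) ≤ ‖g u‖ * D :=
      (real_inner_le_norm _ _).trans (by gcongr; exact hD _ hx1 _ hu)
    have h3 : ‖x 1 - u‖ ^ 2 ≤ D ^ 2 := by gcongr; exact hD _ hx1 _ hu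
    have h4 : L * ‖x 1 - u‖ ^ 2 ≤ L * D ^ 2 := by gcongr
    have h5 : (1 + 1 / ((1 : ℕ) : ℝ)) / (2 * η) * ‖w 1 - u‖ ^ 2 ≤ D ^ 2 / η := by
      rw [hw1, div_mul_eq_mul_div, div_le_div_iff₀ (by positivity) hη]
      push_cast
      nlinarith
    have h6 : 0 ≤ L * D ^ 2 := by positivity
    simp only [Finset.Ico_self, Finset.sum_empty]
    push_cast at h5 ⊢
    linarith
  | succ n hn ih =>
    specialize ih (by omega)
    have hn' : (0 : ℝ) < n := by exact_mod_cast hn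
    have hxn := hxK n hn (by omega)
    have hwn := (hw n hn (by omega)).1
    have hqn := (abs_le.1 (hq _ hxn _ (hxK (n + 1) (by omega) hnT))).2
    have hcn := hf.inner_le_sub_of_quadratic hq hxn hu
    have hreg := (hw n hn (by omega)).regret hf.1 hu
    have hrec := hx n hn (by omega)
    rw [show x (n + 1) - x n = (2 / ((n : ℝ) + 2)) • (w (n + 1) - x n) by
      rw [hrec]; abel, real_inner_smul_right, norm_smul, mul_pow, Real.norm_eq_abs, sq_abs] at hqn
    have hdist : ‖w (n + 1) - x n‖ ^ 2 ≤ D ^ 2 := by gcongr; exact hD _ hwn _ hxn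
    -- The regret inequality concerns `a n`; replacing it by the true gradient costs `D` times the
    -- error.
    have herr : inner ℝ (g (x n)) (w (n + 1) - u)
        ≤ inner ℝ (a n) (w (n + 1) - u) + D * ‖a n - g (x n)‖ := by
      have h1 : inner ℝ (g (x n) - a n) (w (n + 1) - u) ≤ ‖g (x n) - a n‖ * ‖w (n + 1) - u‖ :=
        real_inner_le_norm _ _
      have h2 : ‖g (x n) - a n‖ * ‖w (n + 1) - u‖ ≤ ‖g (x n) - a n‖ * D := by
        gcongr; exact hD _ hwn _ hu
      rw [inner_sub_left] at h1
      rw [norm_sub_rev (a n)]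
      linarith
    have hsplit : inner ℝ (g (x n)) (w (n + 1) - x n)
        = inner ℝ (g (x n)) (w (n + 1) - u) + inner ℝ (g (x n)) (u - x n) := by
      rw [← inner_add_right]; congr 1; abel
    rw [Finset.sum_Ico_succ_top hn]
    set p := inner ℝ (a n) (w (n + 1) - u)
    set e := D * ‖a n - g (x n)‖
    set F := f (x n) - f u
    have hstep : f (x (n + 1)) - f u ≤ F + 2 / ((n : ℝ) + 2) * (p + e - F)
        + L * ((2 / ((n : ℝ) + 2)) ^ 2 * D ^ 2) := by
      have h1 : 2 / ((n : ℝ) + 2) * inner ℝ (g (x n)) (w (n + 1) - x n)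
          ≤ 2 / ((n : ℝ) + 2) * (p + e - F) := by
        gcongr
        rw [hsplit]; linarith
      have h2 : L * ((2 / ((n : ℝ) + 2)) ^ 2 * ‖w (n + 1) - x n‖ ^ 2)
          ≤ L * ((2 / ((n : ℝ) + 2)) ^ 2 * D ^ 2) := by gcongr
      linarith
    -- The factor `(n+1)(n+2)/2` turns `2/(n+2)` into `n + 1`, leaves `n(n+1)/2` in front of `F`,
    -- and turns the smoothness term into `2LD² (n+1)/(n+2)`.
    have hscaled : (((n : ℝ) + 1) * (n + 1 + 1) / 2) * (f (x (n + 1)) - f u)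
        ≤ (n * (n + 1) / 2) * F + ((n : ℝ) + 1) * (p + e) + 2 * L * D ^ 2 := by
      calc _ ≤ (((n : ℝ) + 1) * (n + 1 + 1) / 2) * (F + 2 / ((n : ℝ) + 2) * (p + e - F)
        + L * ((2 / ((n : ℝ) + 2)) ^ 2 * D ^ 2)) := by gcongr
        _ = (n * (n + 1) / 2) * F + ((n : ℝ) + 1) * (p + e)
            + 2 * L * D ^ 2 * ((n + 1) / (n + 2)) := by field_simp; ring
        _ ≤ _ := by
          have : ((n : ℝ) + 1) / (n + 2) ≤ 1 := by
            rw [div_le_one (by positivity)]; linarith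
          have := mul_le_mul_of_nonneg_left this (by positivity : 0 ≤ 2 * L * D ^ 2)
          linarith
    -- The averaging weight of `w (n + 1)` is `n + 1`, but the step producing it has weight `n`;
    -- hence the factor `1 + 1/n`. It decreases in `n`, so the distances still telescope.
    have hp : ((n : ℝ) + 1) * p
        ≤ (1 + 1 / (n : ℝ)) / (2 * η) * (‖w n - u‖ ^ 2 - ‖w (n + 1) - u‖ ^ 2) := by
      have h1 : ((n : ℝ) + 1) * p = (1 + 1 / (n : ℝ)) / η * (η * n * p) := by field_simp
      rw [h1]
      calc _ ≤ (1 + 1 / (n : ℝ)) / η * ((‖w n - u‖ ^ 2 - ‖w (n + 1) - u‖ ^ 2) / 2) := by gcongr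
        _ = _ := by field_simp
    have hcoef : (1 + 1 / ((n : ℝ) + 1)) / (2 * η) * ‖w (n + 1) - u‖ ^ 2
        ≤ (1 + 1 / (n : ℝ)) / (2 * η) * ‖w (n + 1) - u‖ ^ 2 := by
      gcongr; linarith
    push_cast
    linarith

end Descent

/-! ### Second moments of martingale increments. -/

section SecondMoment

variable {d : ℕ}

theorem enorm_sq_eq_ofReal (v : Vec d) : ‖v‖ₑ ^ 2 = ENNReal.ofReal (‖v‖ ^ 2) := by
  rw [← ofReal_norm, ENNReal.ofReal_pow (norm_nonneg v)]

theorem memLp_two_of_lintegral_le {W : Type*} [MeasurableSpace W] {ν : Measure W} {φ : W → Vec d}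
    (hφ : AEStronglyMeasurable φ ν) {B : ℝ}
    (hB : ∫⁻ z, ‖φ z‖ₑ ^ 2 ∂ν ≤ ENNReal.ofReal B) : MemLp φ 2 ν := by
  refine ⟨hφ, ?_⟩
  rw [eLpNorm_lt_top_iff_lintegral_rpow_enorm_lt_top (by norm_num) (by norm_num)]
  simpa using hB.trans_lt ENNReal.ofReal_lt_top

theorem integral_norm_le_of_lintegral_le {W : Type*} [MeasurableSpace W] {ν : Measure W}
    [IsProbabilityMeasure ν] {φ : W → Vec d} (hφ : AEStronglyMeasurable φ ν) {b : ℝ} (hb : 0 ≤ b)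
    (hB : ∫⁻ z, ‖φ z‖ₑ ^ 2 ∂ν ≤ ENNReal.ofReal (b ^ 2)) :
    Integrable φ ν ∧ ∫ z, ‖φ z‖ ∂ν ≤ b := by
  have h2 := memLp_two_of_lintegral_le hφ hB
  refine ⟨h2.integrable (by norm_num), ?_⟩
  have h3 : eLpNorm φ 1 ν ≤ eLpNorm φ 2 ν := eLpNorm_le_eLpNorm_of_exponent_le (by norm_num) hφ
  have h4 : eLpNorm φ 2 ν ≤ ENNReal.ofReal b := by
    rw [eLpNorm_eq_lintegral_rpow_enorm_toReal (by norm_num) (by norm_num)]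
    simp only [ENNReal.toReal_ofNat, ENNReal.rpow_ofNat, one_div]
    rw [ENNReal.ofReal_pow hb] at hB
    calc _ ≤ (ENNReal.ofReal b ^ 2) ^ (2⁻¹ : ℝ) := by gcongr
      _ = _ := by
        rw [← ENNReal.rpow_natCast, ← ENNReal.rpow_mul]; simp
  rw [integral_norm_eq_lintegral_enorm hφ]
  rw [eLpNorm_one_eq_lintegral_enorm] at h3
  exact ENNReal.toReal_le_of_le_ofReal hb (h3.trans h4)

/-- Expand the square; the cross term integrates to zero because `φ` is centred. -/
theorem lintegral_enorm_const_add_sq_le {W : Type*} [MeasurableSpace W] {ν : Measure W}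
    [IsProbabilityMeasure ν] {φ : W → Vec d} (hφ : AEStronglyMeasurable φ ν)
    (h0 : ∫ z, φ z ∂ν = 0) {B : ℝ} (hB0 : 0 ≤ B) (hB : ∫⁻ z, ‖φ z‖ₑ ^ 2 ∂ν ≤ ENNReal.ofReal B)
    (a : Vec d) : ∫⁻ z, ‖a + φ z‖ₑ ^ 2 ∂ν ≤ ‖a‖ₑ ^ 2 + ENNReal.ofReal B := by
  have h2 := memLp_two_of_lintegral_le hφ hB
  have h1 : Integrable φ ν := h2.integrable (by norm_num)
  have hsq : Integrable (fun z => ‖φ z‖ ^ 2) ν := h2.integrable_norm_pow (by norm_num)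
  have hin : Integrable (fun z => inner ℝ a (φ z)) ν := h1.const_inner a
  have heq : ∀ z, ‖a + φ z‖ ^ 2 = ‖a‖ ^ 2 + 2 * inner ℝ a (φ z) + ‖φ z‖ ^ 2 := fun z =>
    norm_add_sq_real a (φ z)
  have hint : Integrable (fun z => ‖a + φ z‖ ^ 2) ν := by
    simp_rw [heq]
    exact ((integrable_const _).add (hin.const_mul 2)).add hsq
  simp_rw [enorm_sq_eq_ofReal] at hB ⊢
  rw [← ofReal_integral_eq_lintegral_ofReal hsq (.of_forall fun z => by positivity)] at hB
  rw [← ofReal_integral_eq_lintegral_ofReal hint (.of_forall fun z => by positivity),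
    ← ENNReal.ofReal_add (by positivity) hB0]
  rw [ENNReal.ofReal_le_ofReal_iff hB0] at hB
  refine ENNReal.ofReal_le_ofReal ?_
  simp_rw [heq]
  rw [integral_add (by exact (integrable_const _).add (hin.const_mul 2)) hsq,
    integral_add (integrable_const _) (hin.const_mul 2), integral_const_mul, integral_inner h1, h0]
  simpa using hB

/-- A martingale increment adds at most its conditional second moment. -/
theorem lintegral_enorm_add_sq_le_of_indepFun {Ω S W : Type*} [MeasurableSpace Ω]
    [MeasurableSpace S] [MeasurableSpace W] {P : Measure Ω} [IsProbabilityMeasure P]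
    {H : Ω → S} {z : Ω → W} (hH : Measurable H) (hz : Measurable z) (hind : IndepFun H z P)
    {N : S → Vec d} (hN : Measurable N) {φ : S → W → Vec d} (hφ : Measurable (Function.uncurry φ))
    {S₀ : Set S} (hS₀ : MeasurableSet S₀) (hHS : ∀ ω, H ω ∈ S₀)
    (h0 : ∀ s ∈ S₀, ∫ w, φ s w ∂(P.map z) = 0) {B : ℝ} (hB0 : 0 ≤ B)
    (hB : ∀ s ∈ S₀, ∫⁻ w, ‖φ s w‖ₑ ^ 2 ∂(P.map z) ≤ ENNReal.ofReal B) :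
    ∫⁻ ω, ‖N (H ω) + φ (H ω) (z ω)‖ₑ ^ 2 ∂P ≤ ∫⁻ ω, ‖N (H ω)‖ₑ ^ 2 ∂P + ENNReal.ofReal B := by
  have := Measure.isProbabilityMeasure_map (μ := P) hH.aemeasurable
  have := Measure.isProbabilityMeasure_map (μ := P) hz.aemeasurable
  -- By independence the joint law of past and sample is a product, so the past can be frozen and
  -- the sample integrated first.
  have hprod := (indepFun_iff_map_prod_eq_prod_map_map hH.aemeasurable hz.aemeasurable).1 hind
  have hm : Measurable fun p : S × W => ‖N p.1 + φ p.1 p.2‖ₑ ^ 2 :=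
    ((hN.comp measurable_fst).add hφ).enorm.pow_const 2
  have h1 : ∫⁻ ω, ‖N (H ω) + φ (H ω) (z ω)‖ₑ ^ 2 ∂P
      = ∫⁻ s, ∫⁻ w, ‖N s + φ s w‖ₑ ^ 2 ∂(P.map z) ∂(P.map H) := by
    rw [← lintegral_prod (fun p : S × W => ‖N p.1 + φ p.1 p.2‖ₑ ^ 2) hm.aemeasurable, ← hprod,
      lintegral_map hm (hH.prodMk hz)]
  have h2 : ∫⁻ ω, ‖N (H ω)‖ₑ ^ 2 ∂P = ∫⁻ s, ‖N s‖ₑ ^ 2 ∂(P.map H) :=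
    (lintegral_map (hN.enorm.pow_const 2) hH).symm
  rw [h1, h2]
  have hae : ∀ᵐ s ∂(P.map H), s ∈ S₀ :=
    (ae_map_iff hH.aemeasurable hS₀).2 (.of_forall hHS)
  calc _ ≤ ∫⁻ s, (‖N s‖ₑ ^ 2 + ENNReal.ofReal B) ∂(P.map H) := by
        refine lintegral_mono_ae ?_
        filter_upwards [hae] with s hs
        exact lintegral_enorm_const_add_sq_le
          (hφ.comp measurable_prodMk_left).aestronglyMeasurable (h0 s hs) hB0 (hB s hs) (N s)
    _ = _ := by rw [lintegral_add_right _ measurable_const]; simp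

/-- The second moment of a sum of independent centred vectors. -/
theorem lintegral_enorm_sum_sq_le_of_iIndepFun {Ω ι : Type*} [MeasurableSpace Ω] {P : Measure Ω}
    [IsProbabilityMeasure P] {ψ : ι → Ω → Vec d} (hψ : ∀ i, Measurable (ψ i))
    (hind : iIndepFun ψ P) (h0 : ∀ i, ∫ ω, ψ i ω ∂P = 0) {B : ι → ℝ} (hB0 : ∀ i, 0 ≤ B i)
    (hB : ∀ i, ∫⁻ ω, ‖ψ i ω‖ₑ ^ 2 ∂P ≤ ENNReal.ofReal (B i)) (s : Finset ι) :
    ∫⁻ ω, ‖∑ i ∈ s, ψ i ω‖ₑ ^ 2 ∂P ≤ ENNReal.ofReal (∑ i ∈ s, B i) := by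
  classical
  induction s using Finset.induction_on with
  | empty => simp
  | insert i s hi ih =>
    have hHm : Measurable fun ω => ∑ j ∈ s, ψ j ω := by fun_prop
    have hd : IndepFun (fun ω => ∑ j ∈ s, ψ j ω) (ψ i) P := by
      have := hind.indepFun_finsetSum_of_notMem hψ hi
      convert this using 1
      ext ω; simp
    -- The partial sum plays the past and the new summand is itself the sample.
    have := lintegral_enorm_add_sq_le_of_indepFun (N := id) (φ := fun _ w => w) hHm (hψ i) hd
      measurable_id measurable_snd MeasurableSet.univ (fun _ => trivial)
      (fun _ _ => by
        rw [integral_map (hψ i).aemeasurable (by fun_prop)]; exact h0 i) (hB0 i)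
      (fun _ _ => by
        rw [lintegral_map (by fun_prop) (hψ i)]; exact hB i)
    simp_rw [Finset.sum_insert hi, add_comm (ψ i _)]
    rw [add_comm (B i), ENNReal.ofReal_add (Finset.sum_nonneg fun j _ => hB0 j) (hB0 i)]
    exact this.trans (by gcongr; exact ih)

/-- One step of a vector-valued martingale driven by independent samples `z i`. -/
theorem lintegral_enorm_add_sum_sq_le {Ω S W ι : Type*} [Fintype ι] [MeasurableSpace Ω]
    [MeasurableSpace S] [MeasurableSpace W] {P : Measure Ω} [IsProbabilityMeasure P]
    {ν : ι → Measure W} [∀ i, IsProbabilityMeasure (ν i)]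
    {H : Ω → S} {z : Ω → ι → W} (hH : Measurable H) (hz : Measurable z) (hind : IndepFun H z P)
    (hlaw : P.map z = Measure.pi ν)
    {N : S → Vec d} (hN : Measurable N) {φ : ι → S → W → Vec d}
    (hφ : ∀ i, Measurable (Function.uncurry (φ i)))
    {S₀ : Set S} (hS₀ : MeasurableSet S₀) (hHS : ∀ ω, H ω ∈ S₀)
    (h0 : ∀ i, ∀ s ∈ S₀, ∫ w, φ i s w ∂(ν i) = 0) {B : ℝ} (hB0 : 0 ≤ B)
    (hB : ∀ i, ∀ s ∈ S₀, ∫⁻ w, ‖φ i s w‖ₑ ^ 2 ∂(ν i) ≤ ENNReal.ofReal B) (c : ι → ℝ) :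
    ∫⁻ ω, ‖N (H ω) + ∑ i, c i • φ i (H ω) (z ω i)‖ₑ ^ 2 ∂P
      ≤ ∫⁻ ω, ‖N (H ω)‖ₑ ^ 2 ∂P + ENNReal.ofReal (∑ i, c i ^ 2 * B) := by
  have hφs : ∀ i s, Measurable (φ i s) := fun i s => (hφ i).comp measurable_prodMk_left
  have hmp : ∀ i, MeasurePreserving (Function.eval i) (Measure.pi ν) (ν i) :=
    fun i => measurePreserving_eval ν i
  have hmean : ∀ s ∈ S₀, ∀ i, ∫ w, c i • φ i s (w i) ∂(Measure.pi ν) = 0 := fun s hs i => by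
    rw [integral_smul]
    have := integral_map (μ := Measure.pi ν) (hmp i).measurable.aemeasurable
      (f := φ i s) (hφs i s).aestronglyMeasurable
    rw [(hmp i).map_eq, h0 i s hs] at this
    simp only [Function.eval] at this
    rw [← this, smul_zero]
  have hvar : ∀ s ∈ S₀, ∀ i, ∫⁻ w, ‖c i • φ i s (w i)‖ₑ ^ 2 ∂(Measure.pi ν)
      ≤ ENNReal.ofReal (c i ^ 2 * B) := fun s hs i => by
    have h1 := (hmp i).lintegral_comp (f := fun w => ‖φ i s w‖ₑ ^ 2)
      ((hφs i s).enorm.pow_const 2)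
    simp only [Function.eval] at h1
    have h2 : ∀ w : ι → W, ‖c i • φ i s (w i)‖ₑ ^ 2
        = ENNReal.ofReal (c i ^ 2) * ‖φ i s (w i)‖ₑ ^ 2 := fun w => by
      rw [enorm_smul, mul_pow, ← enorm_pow, Real.enorm_of_nonneg (sq_nonneg _)]
    simp_rw [h2]
    rw [lintegral_const_mul' _ _ ENNReal.ofReal_ne_top, h1, ENNReal.ofReal_mul (sq_nonneg _)]
    gcongr
    exact hB i s hs
  refine lintegral_enorm_add_sq_le_of_indepFun (φ := fun s w => ∑ i, c i • φ i s (w i)) hH hz hind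
    hN ?_ hS₀ hHS (fun s hs => ?_) (by positivity) (fun s hs => ?_)
  · refine Finset.measurable_sum _ fun i _ => ?_
    have h1 : Measurable fun p : S × (ι → W) => φ i p.1 (p.2 i) :=
      (hφ i).comp (measurable_fst.prodMk ((measurable_pi_apply i).comp measurable_snd))
    exact h1.const_smul (c i)
  · rw [hlaw, integral_finsetSum _ fun i _ => ?_]
    · exact Finset.sum_eq_zero fun i _ => hmean s hs i
    · exact (memLp_two_of_lintegral_le (((hφs i s).comp (measurable_pi_apply i)).const_smul
        (c i)).aestronglyMeasurable (hvar s hs i)).integrable (by norm_num)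
  · rw [hlaw]
    refine lintegral_enorm_sum_sq_le_of_iIndepFun
      (fun i => ((hφs i s).comp (measurable_pi_apply i)).const_smul (c i)) ?_ (hmean s hs)
      (fun i => by positivity) (hvar s hs) Finset.univ
    exact iIndepFun_pi (X := fun i w => c i • φ i s w)
      fun i => ((hφs i s).const_smul (c i)).aemeasurable

end SecondMoment

/-! ### Robust aggregation conditional on the messages. -/

section Aggregation

variable {d m : ℕ}

theorem measurable_honestMean (G : Finset (Fin m)) :
    Measurable (honestMean G : (Fin m → Vec d) → Vec d) := by
  unfold honestMean
  fun_prop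

/-- Robustness at the Dirac law of `v`: coordinates are then trivially independent and `ρ i` can be
the exact distance to the mean. This removes the independence requirement for the random messages of
a run. -/
theorem IsRobust.lintegral_le {A : Kernel (Fin m → Vec d) (Vec d)} {c δ : ℝ} (hA : IsRobust A c δ)
    {G : Finset (Fin m)} (hG : (1 - δ) * (m : ℝ) ≤ (G.card : ℝ)) (v : Fin m → Vec d) :
    ∫⁻ y, ‖y - honestMean G v‖ₑ ^ 2 ∂(A v)
      ≤ ENNReal.ofReal (c * ((G.card : ℝ)⁻¹ * ∑ i ∈ G, ‖v i - honestMean G v‖ ^ 2)) := by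
  have h := hA G hG (Measure.dirac v) inferInstance ?_ (fun i => ‖v i - honestMean G v‖)
    (fun i _ => norm_nonneg _) (fun i _ => ?_)
  · rwa [lintegral_dirac] at h
  · rw [iIndepFun_iff_measure_inter_preimage_eq_mul]
    intro S sets hsets
    have hm : ∀ i ∈ S, MeasurableSet ((fun v : Fin m → Vec d => v i) ⁻¹' sets i) := fun i hi =>
      measurable_pi_apply _ (hsets i hi)
    rw [Measure.dirac_apply' _ (Finset.measurableSet_biInter S hm)]
    rw [Finset.prod_congr rfl fun i hi => Measure.dirac_apply' v (hm i hi)]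
    by_cases hv : ∀ i ∈ S, v i ∈ sets i
    · rw [Finset.prod_eq_one fun i hi => by simpa [Set.indicator] using hv i hi]
      simp [Set.indicator]
      intro i hi hiS
      exact hv ⟨i, hi⟩ hiS
    · push Not at hv
      obtain ⟨i, hi, hvi⟩ := hv
      rw [Finset.prod_eq_zero hi (by simp [Set.indicator, hvi])]
      rw [Set.indicator_of_notMem]
      simp only [Set.mem_iInter, not_forall]
      exact ⟨i, hi, hvi⟩
  · rw [lintegral_dirac, enorm_sq_eq_ofReal]

theorem HasCondLaw.lintegral_eq {Ω : Type*} {𝓐 : MeasurableSpace Ω} [mΩ : MeasurableSpace Ω]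
    {P : Measure Ω} [IsProbabilityMeasure P] (h𝓐 : 𝓐 ≤ mΩ) {Y : Ω → Vec d}
    (hY : Measurable Y) {A : Kernel (Fin m → Vec d) (Vec d)} [IsMarkovKernel A]
    {v : Ω → Fin m → Vec d} (hv : Measurable[𝓐] v) (h : HasCondLaw P 𝓐 Y (fun ω => A (v ω)))
    {F : (Fin m → Vec d) × Vec d → ENNReal} (hF : Measurable F) :
    ∫⁻ ω, F (v ω, Y ω) ∂P = ∫⁻ ω, ∫⁻ y, F (v ω, y) ∂(A (v ω)) ∂P := by
  have hv' : Measurable v := hv.mono h𝓐 le_rfl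
  have := Measure.isProbabilityMeasure_map (μ := P) hv'.aemeasurable
  have hlaw : P.map (fun ω => (v ω, Y ω)) = (P.map v) ⊗ₘ A := by
    have := Measure.isProbabilityMeasure_map (μ := P) (hv'.prodMk hY).aemeasurable
    -- The conditional law prescribes the joint law on rectangles, and these determine it.
    refine Measure.ext_prod fun {s t} hs ht => ?_
    rw [Measure.map_apply (hv'.prodMk hY) (hs.prod ht), Measure.compProd_apply_prod hs ht,
      setLIntegral_map hs (A.measurable_coe ht) hv']
    exact h (v ⁻¹' s) (hv hs) t ht
  rw [← lintegral_map hF (hv'.prodMk hY), hlaw, Measure.lintegral_compProd hF,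
    lintegral_map (Measurable.lintegral_kernel_prod_right' hF) hv']

end Aggregation

/-! ### Measurability and regularity of the gradients. -/

section Gradient

variable {d m : ℕ} {Z : Type*} [MeasurableSpace Z] {K : Set (Vec d)} {G : Finset (Fin m)}
  {𝒟 : Fin m → Measure Z}
  {loss : Fin m → Vec d → Z → ℝ} {grad : Fin m → Vec d → Z → Vec d} {L σ σL ξ : ℝ}

/-- A jointly measurable version of the stochastic gradient on `K`. -/
theorem SmoothStochasticLosses.exists_measurable_grad
    (h : SmoothStochasticLosses K G 𝒟 loss grad L σ σL ξ) {π : Vec d → Vec d}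
    (hπ : Continuous π) (hπK : ∀ v, π v ∈ K) (hπid : ∀ v ∈ K, π v = v) {i : Fin m} (hi : i ∈ G) :
    ∃ g : Vec d → Z → Vec d, Measurable (Function.uncurry g) ∧
      ∀ᵐ z ∂(𝒟 i), ∀ x ∈ K, g x z = grad i x z := by
  classical
  have hs := h.smooth i hi
  -- A measurable null set outside which the gradient is Lipschitz on `K`. Set to zero on it and
  -- composed with `π`, the gradient is continuous in `x` and measurable in `z`, hence jointly
  -- measurable.
  set bad := toMeasurable (𝒟 i)
    {z | ¬ ∀ x ∈ K, ∀ y ∈ K, ‖grad i x z - grad i y z‖ ≤ L * ‖x - y‖}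
  have hbad : 𝒟 i bad = 0 := by rw [measure_toMeasurable]; exact hs
  have hgood : ∀ z ∉ bad, ∀ x ∈ K, ∀ y ∈ K, ‖grad i x z - grad i y z‖ ≤ L * ‖x - y‖ :=
    fun z hz => by
      by_contra hc
      exact hz (subset_toMeasurable _ _ hc)
  refine ⟨fun x z => badᶜ.indicator (grad i (π x)) z,
    measurable_uncurry_of_continuous_of_measurable (fun z => ?_) (fun x => ?_), ?_⟩
  · by_cases hz : z ∈ bad
    · simpa [hz] using continuous_const
    · simp only [Set.indicator_of_mem (show z ∈ badᶜ from hz)]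
      refine ContinuousOn.comp_continuous (s := K) (g := fun x => grad i x z) ?_ hπ hπK
      refine (LipschitzOnWith.of_dist_le_mul (K := L.toNNReal) fun x hx y hy => ?_).continuousOn
      rw [dist_eq_norm, dist_eq_norm]
      refine (hgood z hz x hx y hy).trans ?_
      gcongr
      exact Real.le_coe_toNNReal L
  · exact (h.measurable_grad i hi _ (hπK x)).indicator (measurableSet_toMeasurable _ _).compl
  · filter_upwards [measure_eq_zero_iff_ae_notMem.1 hbad] with z hz x hx
    rw [Set.indicator_of_mem (show z ∈ badᶜ from hz), hπid x hx]

variable [∀ i, IsProbabilityMeasure (𝒟 i)]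

theorem SmoothStochasticLosses.norm_localGrad_sub_le
    (h : SmoothStochasticLosses K G 𝒟 loss grad L σ σL ξ) {i : Fin m} (hi : i ∈ G)
    {x y : Vec d} (hx : x ∈ K) (hy : y ∈ K) :
    ‖localGrad 𝒟 grad i x - localGrad 𝒟 grad i y‖ ≤ L * ‖x - y‖ := by
  unfold localGrad
  rw [← integral_sub (h.integrable_grad hi hx) (h.integrable_grad hi hy)]
  have := norm_integral_le_of_norm_le_const (μ := 𝒟 i)
    (f := fun z => grad i x z - grad i y z) (C := L * ‖x - y‖)
    (by filter_upwards [h.smooth i hi] with z hz using hz x hx y hy)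
  simpa using this

theorem norm_honestMean_le (hG : 0 < G.card) {v : Fin m → Vec d} {b : ℝ}
    (hv : ∀ i ∈ G, ‖v i‖ ≤ b) : ‖honestMean G v‖ ≤ b := by
  have hc : (0 : ℝ) < G.card := by exact_mod_cast hG
  rw [honestMean, norm_smul, norm_inv, Real.norm_of_nonneg hc.le, inv_mul_le_iff₀ hc]
  simpa using norm_sum_le_of_le G hv

theorem honestMean_sub (u v : Fin m → Vec d) :
    honestMean G u - honestMean G v = honestMean G (fun i => u i - v i) := by
  simp [honestMean, Finset.sum_sub_distrib, smul_sub]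

theorem SmoothStochasticLosses.norm_objGrad_sub_le
    (h : SmoothStochasticLosses K G 𝒟 loss grad L σ σL ξ) (hG : 0 < G.card)
    {x y : Vec d} (hx : x ∈ K) (hy : y ∈ K) :
    ‖objGrad G 𝒟 grad x - objGrad G 𝒟 grad y‖ ≤ L * ‖x - y‖ := by
  rw [objGrad, objGrad, honestMean_sub]
  exact norm_honestMean_le hG fun i hi => h.norm_localGrad_sub_le hi hx hy

theorem SmoothStochasticLosses.hasGradientWithinAt_objective (hK : Convex ℝ K) (hL : 0 ≤ L)
    (h : SmoothStochasticLosses K G 𝒟 loss grad L σ σL ξ) {x : Vec d} (hx : x ∈ K) :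
    HasGradientWithinAt (objective G 𝒟 loss) (objGrad G 𝒟 grad x) K x := by
  rw [hasGradientWithinAt_iff_hasFDerivWithinAt]
  have h1 : HasFDerivWithinAt (fun y => ∑ i ∈ G, localObj 𝒟 loss i y)
      (∑ i ∈ G, InnerProductSpace.toDual ℝ (Vec d) (localGrad 𝒟 grad i x)) K x :=
    HasFDerivWithinAt.fun_sum fun i hi =>
      (hasGradientWithinAt_localObj hK hL h hi hx).hasFDerivWithinAt
  have h2 := h1.const_mul (G.card : ℝ)⁻¹
  have h3 : InnerProductSpace.toDual ℝ (Vec d) (objGrad G 𝒟 grad x)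
      = (G.card : ℝ)⁻¹ • ∑ i ∈ G, InnerProductSpace.toDual ℝ (Vec d) (localGrad 𝒟 grad i x) := by
    simp [objGrad, honestMean, map_sum]
  rw [h3]
  exact h2

end Gradient

/-! ### Noise created by one fresh sample. -/

section Noise

variable {d m : ℕ} {Z : Type*} [MeasurableSpace Z] {K : Set (Vec d)} {G : Finset (Fin m)}
  {𝒟 : Fin m → Measure Z}
  {loss : Fin m → Vec d → Z → ℝ} {grad : Fin m → Vec d → Z → Vec d} {L σ σL ξ : ℝ}

theorem two_mul_ofReal (a : ℝ) : 2 * ENNReal.ofReal a = ENNReal.ofReal (2 * a) := by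
  rw [ENNReal.ofReal_mul (by norm_num)]
  simp

theorem enorm_add_sq_le (u v : Vec d) : ‖u + v‖ₑ ^ 2 ≤ 2 * ‖u‖ₑ ^ 2 + 2 * ‖v‖ₑ ^ 2 := by
  rw [enorm_sq_eq_ofReal, enorm_sq_eq_ofReal, enorm_sq_eq_ofReal, two_mul_ofReal, two_mul_ofReal,
    ← ENNReal.ofReal_add (by positivity) (by positivity)]
  refine ENNReal.ofReal_le_ofReal ?_
  have h := norm_add_le u v
  have h' : ‖u + v‖ ^ 2 ≤ (‖u‖ + ‖v‖) ^ 2 := by gcongr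
  nlinarith [sq_nonneg (‖u‖ - ‖v‖)]

/-- The increment of the scaled momentum error caused by one fresh sample. -/
noncomputable def momentumNoise (𝒟 : Fin m → Measure Z) (grad : Fin m → Vec d → Z → Vec d)
    (i : Fin m) (a : ℝ) (x y : Vec d) (z : Z) : Vec d :=
  a • ((grad i x z - localGrad 𝒟 grad i x) - (grad i y z - localGrad 𝒟 grad i y))
    + (grad i x z - localGrad 𝒟 grad i x)

/-- From `‖u + v‖² ≤ 2‖u‖² + 2‖v‖²`: the smoothness part contributes `2 a² σL² ‖x - y‖² ≤ 8 D² σL²`.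
-/
theorem SmoothStochasticLosses.lintegral_momentumNoise_le
    (h : SmoothStochasticLosses K G 𝒟 loss grad L σ σL ξ) {i : Fin m} (hi : i ∈ G) {a D : ℝ}
    (ha : 0 ≤ a) {x y : Vec d} (hx : x ∈ K) (hy : y ∈ K) (hxy : a * ‖x - y‖ ≤ 2 * D) :
    ∫⁻ z, ‖momentumNoise 𝒟 grad i a x y z‖ₑ ^ 2 ∂(𝒟 i)
      ≤ ENNReal.ofReal (2 * σ ^ 2 + 8 * D ^ 2 * σL ^ 2) := by
  have hm : Measurable fun z => ‖grad i x z - localGrad 𝒟 grad i x‖ₑ ^ 2 :=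
    ((h.measurable_grad i hi x hx).sub_const _).enorm.pow_const 2
  have hsm : ∀ v : Vec d, ‖a • v‖ₑ ^ 2 = ENNReal.ofReal (a ^ 2) * ‖v‖ₑ ^ 2 := fun v => by
    rw [enorm_smul, mul_pow, ← enorm_pow, Real.enorm_of_nonneg (sq_nonneg _)]
  have hxy2 : (a * ‖x - y‖) ^ 2 ≤ (2 * D) ^ 2 := by gcongr
  calc _ ≤ ∫⁻ z, (2 * (ENNReal.ofReal (a ^ 2) * ‖(grad i x z - localGrad 𝒟 grad i x)
          - (grad i y z - localGrad 𝒟 grad i y)‖ₑ ^ 2)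
          + 2 * ‖grad i x z - localGrad 𝒟 grad i x‖ₑ ^ 2) ∂(𝒟 i) := by
        refine lintegral_mono fun z => ?_
        rw [← hsm]
        exact enorm_add_sq_le _ _
    _ = 2 * (ENNReal.ofReal (a ^ 2) * ∫⁻ z, ‖(grad i x z - localGrad 𝒟 grad i x)
          - (grad i y z - localGrad 𝒟 grad i y)‖ₑ ^ 2 ∂(𝒟 i))
          + 2 * ∫⁻ z, ‖grad i x z - localGrad 𝒟 grad i x‖ₑ ^ 2 ∂(𝒟 i) := by
        rw [lintegral_add_right _ (hm.const_mul 2), lintegral_const_mul' _ _ (by simp),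
          lintegral_const_mul' _ _ (by simp), lintegral_const_mul' _ _ (by simp)]
    _ ≤ 2 * (ENNReal.ofReal (a ^ 2) * ENNReal.ofReal (σL ^ 2 * ‖x - y‖ ^ 2))
          + 2 * ENNReal.ofReal (σ ^ 2) := by
        gcongr
        · exact h.smoothVariance i hi x hx y hy
        · exact h.variance i hi x hx
    _ = ENNReal.ofReal (2 * (a ^ 2 * (σL ^ 2 * ‖x - y‖ ^ 2)) + 2 * σ ^ 2) := by
        rw [← ENNReal.ofReal_mul (sq_nonneg a), two_mul_ofReal, two_mul_ofReal,
          ENNReal.ofReal_add (by positivity) (by positivity)]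
    _ ≤ _ := by
        refine ENNReal.ofReal_le_ofReal ?_
        nlinarith [sq_nonneg σL]

variable [∀ i, IsProbabilityMeasure (𝒟 i)]

theorem SmoothStochasticLosses.integral_momentumNoise
    (h : SmoothStochasticLosses K G 𝒟 loss grad L σ σL ξ) {i : Fin m} (hi : i ∈ G) (a : ℝ)
    {x y : Vec d} (hx : x ∈ K) (hy : y ∈ K) :
    ∫ z, momentumNoise 𝒟 grad i a x y z ∂(𝒟 i) = 0 := by
  have hc : ∀ x ∈ K, Integrable (fun z => grad i x z - localGrad 𝒟 grad i x) (𝒟 i) ∧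
      ∫ z, (grad i x z - localGrad 𝒟 grad i x) ∂(𝒟 i) = 0 := fun x hx => by
    refine ⟨(h.integrable_grad hi hx).sub (integrable_const _), ?_⟩
    rw [integral_sub (h.integrable_grad hi hx) (integrable_const _)]
    simp [localGrad]
  have hs : Integrable (fun z => a • ((grad i x z - localGrad 𝒟 grad i x)
      - (grad i y z - localGrad 𝒟 grad i y))) (𝒟 i) := ((hc x hx).1.sub (hc y hy).1).smul a
  unfold momentumNoise
  rw [integral_add hs (hc x hx).1, integral_smul,
    integral_sub (hc x hx).1 (hc y hy).1, (hc x hx).2, (hc y hy).2]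
  simp

theorem SmoothStochasticLosses.measurable_localGrad_comp
    (h : SmoothStochasticLosses K G 𝒟 loss grad L σ σL ξ) {π : Vec d → Vec d}
    (hπ : Continuous π) (hπK : ∀ v, π v ∈ K) {i : Fin m} (hi : i ∈ G) :
    Measurable fun v => localGrad 𝒟 grad i (π v) := by
  refine (ContinuousOn.comp_continuous (s := K) (g := localGrad 𝒟 grad i) ?_ hπ hπK).measurable
  refine (LipschitzOnWith.of_dist_le_mul (K := L.toNNReal) fun x hx y hy => ?_).continuousOn
  rw [dist_eq_norm, dist_eq_norm]
  refine (h.norm_localGrad_sub_le hi hx hy).trans ?_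
  gcongr
  exact Real.le_coe_toNNReal L

/-- A jointly measurable version of the momentum noise on `K`. -/
theorem SmoothStochasticLosses.exists_measurable_momentumNoise
    (h : SmoothStochasticLosses K G 𝒟 loss grad L σ σL ξ) {π : Vec d → Vec d}
    (hπ : Continuous π) (hπK : ∀ v, π v ∈ K) (hπid : ∀ v ∈ K, π v = v) {i : Fin m} (hi : i ∈ G)
    (a : ℝ) :
    ∃ φ : Vec d × Vec d → Z → Vec d, Measurable (Function.uncurry φ) ∧
      ∀ᵐ z ∂(𝒟 i), ∀ x ∈ K, ∀ y ∈ K, φ (x, y) z = momentumNoise 𝒟 grad i a x y z := by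
  obtain ⟨g, hgm, hg⟩ := h.exists_measurable_grad hπ hπK hπid hi
  have hlg := h.measurable_localGrad_comp hπ hπK hi
  have hu : Measurable fun p : Vec d × Z => g p.1 p.2 - localGrad 𝒟 grad i (π p.1) :=
    hgm.sub (hlg.comp measurable_fst)
  have h1 : Measurable fun p : (Vec d × Vec d) × Z =>
      g p.1.1 p.2 - localGrad 𝒟 grad i (π p.1.1) :=
    hu.comp (measurable_fst.fst.prodMk measurable_snd)
  have h2 : Measurable fun p : (Vec d × Vec d) × Z =>
      g p.1.2 p.2 - localGrad 𝒟 grad i (π p.1.2) :=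
    hu.comp (measurable_fst.snd.prodMk measurable_snd)
  refine ⟨fun s w => a • ((g s.1 w - localGrad 𝒟 grad i (π s.1))
      - (g s.2 w - localGrad 𝒟 grad i (π s.2))) + (g s.1 w - localGrad 𝒟 grad i (π s.1)),
    ((h1.sub h2).const_smul a).add h1, ?_⟩
  filter_upwards [hg] with z hz x hx y hy
  simp only [momentumNoise, hz _ hx, hz _ hy, hπid _ hx, hπid _ hy]

/-- Fresh noise at past-measurable points, averaged with weights `c` over the workers, adds at most
its variance to the second moment of a past-measurable vector. -/
theorem SmoothStochasticLosses.lintegral_add_sum_momentumNoise_le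
    (h : SmoothStochasticLosses K G 𝒟 loss grad L σ σL ξ) {π : Vec d → Vec d}
    (hπ : Continuous π) (hπK : ∀ v, π v ∈ K) (hπid : ∀ v ∈ K, π v = v) (hKc : IsClosed K)
    {Ω : Type*} {past : MeasurableSpace Ω} [mΩ : MeasurableSpace Ω] {P : Measure Ω}
    [IsProbabilityMeasure P] (hpast : past ≤ mΩ) {z : G → Ω → Z} (hz : ∀ i, Measurable (z i))
    (hind : Indep (MeasurableSpace.comap (fun ω i => z i ω) inferInstance) past P)
    (hlaw : P.map (fun ω i => z i ω) = Measure.pi fun i : G => 𝒟 i)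
    {a D : ℝ} (ha : 0 ≤ a) {N X Y : Ω → Vec d} (hN : Measurable[past] N) (hX : Measurable[past] X)
    (hY : Measurable[past] Y) (hXK : ∀ ω, X ω ∈ K) (hYK : ∀ ω, Y ω ∈ K)
    (hXY : ∀ ω, a * ‖X ω - Y ω‖ ≤ 2 * D) (c : G → ℝ) :
    ∫⁻ ω, ‖N ω + ∑ i : G, c i • momentumNoise 𝒟 grad i a (X ω) (Y ω) (z i ω)‖ₑ ^ 2 ∂P
      ≤ ∫⁻ ω, ‖N ω‖ₑ ^ 2 ∂P
        + ENNReal.ofReal (∑ i : G, c i ^ 2 * (2 * σ ^ 2 + 8 * D ^ 2 * σL ^ 2)) := by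
  have hzm : Measurable fun ω (i : G) => z i ω := measurable_pi_lambda _ hz
  choose φ hφm hφ using fun i : G => h.exists_measurable_momentumNoise hπ hπK hπid i.2 a
  have hS₀ : MeasurableSet {s : Vec d × Vec d × Vec d |
      s.2.1 ∈ K ∧ s.2.2 ∈ K ∧ a * ‖s.2.1 - s.2.2‖ ≤ 2 * D} := by
    have h1 : Continuous fun s : Vec d × Vec d × Vec d => s.2.1 := by fun_prop
    have h2 : Continuous fun s : Vec d × Vec d × Vec d => s.2.2 := by fun_prop
    have h3 : IsClosed {s : Vec d × Vec d × Vec d | a * ‖s.2.1 - s.2.2‖ ≤ 2 * D} :=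
      isClosed_le (continuous_const.mul (h1.sub h2).norm) continuous_const
    exact ((hKc.preimage h1).inter ((hKc.preimage h2).inter h3)).measurableSet
  have hH : Measurable[past] fun ω => (N ω, X ω, Y ω) := hN.prodMk (hX.prodMk hY)
  have hH' : Measurable fun ω => (N ω, X ω, Y ω) := hH.mono hpast le_rfl
  have hindep : IndepFun (fun ω => (N ω, X ω, Y ω)) (fun ω (i : G) => z i ω) P := by
    rw [IndepFun_iff_Indep]
    exact (indep_of_indep_of_le_right hind hH.comap_le).symm
  have hφm' : ∀ i, Measurable (Function.uncurry
      fun (s : Vec d × Vec d × Vec d) w => φ i s.2 w) := fun i =>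
    (hφm i).comp (measurable_fst.snd.prodMk measurable_snd)
  have hmain := lintegral_enorm_add_sum_sq_le (ν := fun i : G => 𝒟 i)
    (N := fun s : Vec d × Vec d × Vec d => s.1)
    (φ := fun i s w => φ i s.2 w) hH' hzm hindep hlaw measurable_fst hφm' hS₀
    (fun ω => ⟨hXK ω, hYK ω, hXY ω⟩)
    (fun i s hs => by
      rw [← h.integral_momentumNoise i.2 a hs.1 hs.2.1]
      refine integral_congr_ae ?_
      filter_upwards [hφ i] with w hw using hw _ hs.1 _ hs.2.1)
    (B := 2 * σ ^ 2 + 8 * D ^ 2 * σL ^ 2) (by positivity)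
    (fun i s hs => by
      refine le_trans (le_of_eq ?_) (h.lintegral_momentumNoise_le i.2 ha hs.1 hs.2.1 hs.2.2)
      refine lintegral_congr_ae ?_
      filter_upwards [hφ i] with w hw
      rw [← hw _ hs.1 _ hs.2.1]) c
  have hzi : ∀ i : G, P.map (z i) = 𝒟 i := fun i => by
    have h1 := Measure.map_map (μ := P) (measurable_pi_apply i) hzm
    rw [hlaw, (measurePreserving_eval (fun i : G => 𝒟 i) i).map_eq] at h1
    exact h1.symm
  -- The measurable version may be evaluated at the random points `X ω`, `Y ω` because its
  -- exceptional null set is the same for all points of `K`.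
  have hae : ∀ᵐ ω ∂P, ∀ i : G, φ i (X ω, Y ω) (z i ω)
      = momentumNoise 𝒟 grad i a (X ω) (Y ω) (z i ω) := by
    rw [ae_all_iff]
    intro i
    have := hφ i
    rw [← hzi i] at this
    filter_upwards [ae_of_ae_map (hz i).aemeasurable this] with ω hω
      using hω _ (hXK ω) _ (hYK ω)
  refine le_trans (le_of_eq (lintegral_congr_ae ?_)) hmain
  filter_upwards [hae] with ω hω
  simp only [hω]

end Noise

/-! ### Iterates of a run and their momentum errors. -/

section Run

variable {d m : ℕ} {Z : Type*} [MeasurableSpace Z] {K : Set (Vec d)} {G : Finset (Fin m)}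
  {𝒟 : Fin m → Measure Z} {grad : Fin m → Vec d → Z → Vec d}
  {A : Kernel (Fin m → Vec d) (Vec d)} {η : ℝ} {T : ℕ} {Ω : Type*} [MeasurableSpace Ω]
  {P : Measure Ω} {x₁ : Vec d} {R : Run Ω Z d m}

theorem IsSyncRun.hist_mono {α β : ℕ → ℝ} (hR : IsSyncRun P K G 𝒟 grad A α β η T x₁ R) :
    Monotone R.hist :=
  monotone_nat_of_le_succ fun t => (hR.hist_le_info t).trans (hR.info_le_hist t)

theorem IsSyncRun.info_le {α β : ℕ → ℝ} (hR : IsSyncRun P K G 𝒟 grad A α β η T x₁ R) (t : ℕ) :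
    R.info t ≤ ‹MeasurableSpace Ω› :=
  (hR.info_le_hist t).trans (hR.hist_le _)

variable (hR : IsSyncRun P K G 𝒟 grad A (fun t => (t : ℝ)) (fun t => 1 / (t : ℝ)) η T x₁ R)

include hR

theorem IsSyncRun.w_mem (hx₁ : x₁ ∈ K) {t : ℕ} (ht : 1 ≤ t) (htT : t ≤ T + 1) (ω : Ω) :
    R.w t ω ∈ K := by
  obtain ⟨s, rfl⟩ : ∃ s, t = s + 1 := ⟨t - 1, by omega⟩
  rcases Nat.eq_zero_or_pos s with rfl | hs
  · rw [zero_add, hR.w_one, hR.x_one]; exact hx₁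
  · exact (hR.w_succ s hs (by omega) ω).1

theorem IsSyncRun.x_eq {t : ℕ} (ht : 1 ≤ t) (htT : t ≤ T + 1) (ω : Ω) :
    R.x t ω = (∑ k ∈ Finset.Icc 1 t, (k : ℝ))⁻¹ • ∑ k ∈ Finset.Icc 1 t, (k : ℝ) • R.w k ω := by
  obtain ⟨s, rfl⟩ : ∃ s, t = s + 1 := ⟨t - 1, by omega⟩
  rcases Nat.eq_zero_or_pos s with rfl | hs
  · simp [hR.w_one]
  · exact hR.x_succ s hs (by omega) ω

theorem IsSyncRun.x_rec {t : ℕ} (ht : 1 ≤ t) (htT : t ≤ T) (ω : Ω) :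
    R.x (t + 1) ω = R.x t ω + (2 / ((t : ℝ) + 2)) • (R.w (t + 1) ω - R.x t ω) :=
  average_succ (w := fun t => R.w t ω) (x := fun t => R.x t ω) (hR.x_eq ht (by omega) ω) ht
    (hR.x_eq (by omega) (by omega) ω)

theorem IsSyncRun.x_mem (hK : Convex ℝ K) (hx₁ : x₁ ∈ K) {t : ℕ} (ht : 1 ≤ t) (htT : t ≤ T + 1)
    (ω : Ω) : R.x t ω ∈ K := by
  induction t, ht using Nat.le_induction with
  | base => rw [hR.x_one]; exact hx₁
  | succ t ht ih =>
    rw [hR.x_rec ht (by omega)]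
    refine hK.add_smul_sub_mem (ih (by omega)) (hR.w_mem hx₁ (by omega) htT ω) ⟨by positivity, ?_⟩
    rw [div_le_one (by positivity)]
    linarith [(Nat.cast_nonneg t : (0 : ℝ) ≤ t)]

/-- Averaging moves the query point only by the fraction `2/(t+2)` towards `w (t + 1)`. This slow
motion keeps the scaled noise increments bounded. -/
theorem IsSyncRun.mul_norm_x_sub_le (hK : Convex ℝ K) (hx₁ : x₁ ∈ K) {D : ℝ}
    (hD : ∀ x ∈ K, ∀ y ∈ K, ‖x - y‖ ≤ D) {t : ℕ} (ht : 1 ≤ t) (htT : t ≤ T) (ω : Ω) :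
    t * ‖R.x (t + 1) ω - R.x t ω‖ ≤ 2 * D := by
  have h1 := hD _ (hR.w_mem hx₁ (by omega) (by omega : t + 1 ≤ T + 1) ω) _
    (hR.x_mem hK hx₁ ht (by omega) ω)
  have hD0 := (norm_nonneg _).trans h1
  have h0 : (0 : ℝ) ≤ t := Nat.cast_nonneg t
  rw [hR.x_rec ht htT, add_sub_cancel_left, norm_smul, Real.norm_of_nonneg (by positivity)]
  calc _ ≤ t * (2 / ((t : ℝ) + 2) * D) := by gcongr
    _ = t / ((t : ℝ) + 2) * (2 * D) := by ring
    _ ≤ 1 * (2 * D) := by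
      gcongr
      rw [div_le_one (by positivity)]; linarith
    _ = _ := one_mul _

theorem IsSyncRun.measurable_w {π : Vec d → Vec d} (hπ : Continuous π)
    (hproj : ∀ v p, IsProj K v p → p = π v) {t : ℕ} (ht : 1 ≤ t) (htT : t ≤ T + 1) :
    Measurable[R.hist t] (R.w t) := by
  induction t, ht using Nat.le_induction with
  | base =>
    have : R.w 1 = fun _ => x₁ := funext fun ω => by rw [hR.w_one, hR.x_one]
    rw [this]; exact measurable_const
  | succ t ht ih =>
    have : R.w (t + 1) = fun ω => π (R.w t ω - (η * t) • R.agg t ω) :=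
      funext fun ω => hproj _ _ (hR.w_succ t ht (by omega) ω)
    rw [this]
    have h1 := (ih (by omega)).mono (hR.hist_mono (Nat.le_succ t)) le_rfl
    exact hπ.measurable.comp (h1.sub ((hR.measurable_agg t ht (by omega)).const_smul (η * t)))

/-- The query point is known when the round begins, hence independent of the samples drawn in it. -/
theorem IsSyncRun.measurable_x {π : Vec d → Vec d} (hπ : Continuous π)
    (hproj : ∀ v p, IsProj K v p → p = π v) {t : ℕ} (ht : 1 ≤ t) (htT : t ≤ T + 1) :
    Measurable[R.hist t] (R.x t) := by
  induction t, ht using Nat.le_induction with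
  | base =>
    have : R.x 1 = fun _ => x₁ := funext hR.x_one
    rw [this]; exact measurable_const
  | succ t ht ih =>
    have : R.x (t + 1) = fun ω => R.x t ω + (2 / ((t : ℝ) + 2)) • (R.w (t + 1) ω - R.x t ω) :=
      funext fun ω => hR.x_rec ht (by omega) ω
    rw [this]
    have h1 := (ih (by omega)).mono (hR.hist_mono (Nat.le_succ t)) le_rfl
    have h2 : Measurable[R.hist (t + 1)] fun ω => R.w (t + 1) ω - R.x t ω :=
      (hR.measurable_w hπ hproj (by omega) htT).sub h1
    exact h1.add (h2.const_smul (2 / ((t : ℝ) + 2)))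

/-- The choice `β (t+1) = 1/(t+1)` gives `(t+1)(1 - β (t+1)) = t`, so the scaled errors accumulate
noise without damping. -/
theorem IsSyncRun.momentum_succ {i : Fin m} (hi : i ∈ G) {t : ℕ} (ht : 1 ≤ t) (htT : t < T)
    (ω : Ω) :
    ((t + 1 : ℕ) : ℝ) • (R.msg (t + 1) i ω - localGrad 𝒟 grad i (R.x (t + 1) ω))
      = (t : ℝ) • (R.msg t i ω - localGrad 𝒟 grad i (R.x t ω))
        + momentumNoise 𝒟 grad i t (R.x (t + 1) ω) (R.x t ω) (R.z (t + 1) i ω) := by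
  have h1 := hR.msg_succ t ht htT i hi ω
  have h2 : (((t + 1 : ℕ) : ℝ)) * (1 - 1 / ((t + 1 : ℕ) : ℝ)) = t := by
    push_cast; field_simp; ring
  rw [h1, momentumNoise, smul_sub, smul_add, smul_smul, h2]
  push_cast
  module

/-- The second moment of any weighted combination of the scaled momentum errors grows linearly. -/
theorem IsSyncRun.lintegral_momentum_le [∀ i, IsProbabilityMeasure (𝒟 i)] [IsProbabilityMeasure P]
    {loss : Fin m → Vec d → Z → ℝ} {L σ σL ξ D : ℝ}
    (h : SmoothStochasticLosses K G 𝒟 loss grad L σ σL ξ)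
    (hK : IsCompact K) (hKc : Convex ℝ K) (hx₁ : x₁ ∈ K) (hD : ∀ x ∈ K, ∀ y ∈ K, ‖x - y‖ ≤ D)
    (c : G → ℝ) {t : ℕ} (ht : 1 ≤ t) (htT : t ≤ T) :
    ∫⁻ ω, ‖∑ i : G, c i • ((t : ℝ) • (R.msg t i ω - localGrad 𝒟 grad i (R.x t ω)))‖ₑ ^ 2 ∂P
      ≤ ENNReal.ofReal (t * ∑ i : G, c i ^ 2 * (2 * σ ^ 2 + 8 * D ^ 2 * σL ^ 2)) := by
  obtain ⟨π, hπ, hπK, hπid, hproj⟩ := exists_continuous_proj hK hKc ⟨x₁, hx₁⟩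
  have hD0 : 0 ≤ D := (norm_nonneg _).trans (hD _ hx₁ _ hx₁)
  have hzm : ∀ t, 1 ≤ t → t ≤ T → ∀ i : G, Measurable (R.z t i) := fun t ht htT i =>
    (hR.measurable_z t ht htT i i.2).mono (hR.info_le t) le_rfl
  induction t, ht using Nat.le_induction with
  | base =>
    -- Round one is the noise step with zero past, `a = 0` and both points equal to `x₁`.
    have := h.lintegral_add_sum_momentumNoise_le hπ hπK hπid hK.isClosed (hR.hist_le 1)
      (hzm 1 le_rfl htT) (hR.indep_z 1 le_rfl htT) (hR.law_z 1 le_rfl htT) (a := 0) (D := D) le_rfl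
      (N := fun _ => 0) (X := fun _ => x₁) (Y := fun _ => x₁) measurable_const measurable_const
      measurable_const (fun _ => hx₁) (fun _ => hx₁) (fun _ => by simpa using hD0) c
    refine le_trans (le_of_eq (lintegral_congr fun ω => ?_)) (this.trans (le_of_eq (by simp)))
    have e : ∀ i : G, ((1 : ℕ) : ℝ) • (R.msg 1 i ω - localGrad 𝒟 grad i (R.x 1 ω))
        = momentumNoise 𝒟 grad i 0 x₁ x₁ (R.z 1 i ω) := fun i => by
      rw [hR.msg_one i i.2, hR.x_one]
      simp [momentumNoise]
    simp_rw [e, zero_add]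
  | succ t ht ih =>
    have hxm := hR.measurable_x hπ hproj (by omega) (by omega : t ≤ T + 1)
    have hle := hR.hist_mono (Nat.le_succ t)
    have hxlg : ∀ i ∈ G, Measurable[R.hist (t + 1)] fun ω => localGrad 𝒟 grad i (R.x t ω) :=
      fun i hi => by
        have e : (fun ω => localGrad 𝒟 grad i (R.x t ω))
            = fun ω => localGrad 𝒟 grad i (π (R.x t ω)) := funext fun ω => by
          rw [hπid _ (hR.x_mem hKc hx₁ ht (by omega) ω)]
        rw [e]
        exact (h.measurable_localGrad_comp hπ hπK hi).comp (hxm.mono hle le_rfl)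
    have hNm : Measurable[R.hist (t + 1)] fun ω => ∑ i : G, c i • ((t : ℝ) • (R.msg t i ω
        - localGrad 𝒟 grad i (R.x t ω))) := by
      refine Finset.measurable_sum _ fun i _ => ?_
      have h1 : Measurable[R.hist (t + 1)] fun ω => R.msg t i ω
          - localGrad 𝒟 grad i (R.x t ω) :=
        ((hR.measurable_msg t ht (by omega) i).mono (hR.info_le_hist t) le_rfl).sub (hxlg i i.2)
      have h2 : Measurable[R.hist (t + 1)] fun ω => (t : ℝ) • (R.msg t i ω
          - localGrad 𝒟 grad i (R.x t ω)) := h1.const_smul (t : ℝ)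
      exact h2.const_smul (c i)
    have := h.lintegral_add_sum_momentumNoise_le hπ hπK hπid hK.isClosed (hR.hist_le (t + 1))
      (hzm (t + 1) (by omega) htT) (hR.indep_z (t + 1) (by omega) htT)
      (hR.law_z (t + 1) (by omega) htT) (a := t) (D := D) (Nat.cast_nonneg t)
      hNm (hR.measurable_x hπ hproj (by omega) (by omega)) (hxm.mono hle le_rfl)
      (fun ω => hR.x_mem hKc hx₁ (by omega) (by omega) ω)
      (fun ω => hR.x_mem hKc hx₁ ht (by omega) ω)
      (fun ω => hR.mul_norm_x_sub_le hKc hx₁ hD ht (by omega) ω) c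
    simp_rw [fun ω (i : G) => hR.momentum_succ i.2 ht (by omega) ω, smul_add,
      Finset.sum_add_distrib]
    refine this.trans ((add_le_add_left (ih (by omega)) _).trans ?_)
    rw [← ENNReal.ofReal_add (by positivity) (by positivity)]
    refine ENNReal.ofReal_le_ofReal (le_of_eq ?_)
    push_cast
    ring

end Run

/-! ### The mean minimizes the sum of squared distances. -/

section HonestMean

variable {d m : ℕ}

theorem sum_norm_sub_honestMean_sq_le {G : Finset (Fin m)} (hG : 0 < G.card) (v : Fin m → Vec d)
    (u : Vec d) : ∑ i ∈ G, ‖v i - honestMean G v‖ ^ 2 ≤ ∑ i ∈ G, ‖v i - u‖ ^ 2 := by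
  have hc : (G.card : ℝ) ≠ 0 := by exact_mod_cast hG.ne'
  have h0 : ∑ i ∈ G, (v i - honestMean G v) = 0 := by
    rw [Finset.sum_sub_distrib, Finset.sum_const, honestMean, ← Nat.cast_smul_eq_nsmul ℝ,
      smul_smul, mul_inv_cancel₀ hc, one_smul, sub_self]
  have h1 : ∀ i, ‖v i - u‖ ^ 2 = ‖v i - honestMean G v‖ ^ 2
      + 2 * inner ℝ (v i - honestMean G v) (honestMean G v - u) + ‖honestMean G v - u‖ ^ 2 :=
    fun i => by rw [← norm_add_sq_real, sub_add_sub_cancel]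
  simp_rw [h1, Finset.sum_add_distrib, ← Finset.mul_sum, ← sum_inner, h0, inner_zero_left]
  simp only [Finset.sum_const, nsmul_eq_mul, mul_zero, add_zero]
  have : 0 ≤ (G.card : ℝ) * ‖honestMean G v - u‖ ^ 2 := by positivity
  linarith

end HonestMean

/-! ### Gradient error of the server and expected suboptimality. -/

section Run

variable {d m : ℕ} {Z : Type*} [MeasurableSpace Z] {K : Set (Vec d)} {G : Finset (Fin m)}
  {𝒟 : Fin m → Measure Z} {loss : Fin m → Vec d → Z → ℝ} {grad : Fin m → Vec d → Z → Vec d}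
  {A : Kernel (Fin m → Vec d) (Vec d)} {η : ℝ} {T : ℕ} {Ω : Type*} [MeasurableSpace Ω]
  {P : Measure Ω} {x₁ : Vec d} {R : Run Ω Z d m} {L σ σL ξ D c δ : ℝ}
  [∀ i, IsProbabilityMeasure (𝒟 i)]
  (hR : IsSyncRun P K G 𝒟 grad A (fun t => (t : ℝ)) (fun t => 1 / (t : ℝ)) η T x₁ R)
  (h : SmoothStochasticLosses K G 𝒟 loss grad L σ σL ξ)
  (hK : IsCompact K) (hKc : Convex ℝ K) (hx₁ : x₁ ∈ K) (hD : ∀ x ∈ K, ∀ y ∈ K, ‖x - y‖ ≤ D)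

include hR h hK hKc hx₁

theorem IsSyncRun.measurable_localGrad_x {i : Fin m} (hi : i ∈ G) {t : ℕ} (ht : 1 ≤ t)
    (htT : t ≤ T) : Measurable fun ω => localGrad 𝒟 grad i (R.x t ω) := by
  obtain ⟨π, hπ, hπK, hπid, hproj⟩ := exists_continuous_proj hK hKc ⟨x₁, hx₁⟩
  have e : (fun ω => localGrad 𝒟 grad i (R.x t ω))
      = fun ω => localGrad 𝒟 grad i (π (R.x t ω)) := funext fun ω => by
    rw [hπid _ (hR.x_mem hKc hx₁ ht (by omega) ω)]
  rw [e]
  exact (h.measurable_localGrad_comp hπ hπK hi).comp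
    ((hR.measurable_x hπ hproj ht (by omega)).mono (hR.hist_le t) le_rfl)

theorem IsSyncRun.measurable_objGrad_x {t : ℕ} (ht : 1 ≤ t) (htT : t ≤ T) :
    Measurable fun ω => objGrad G 𝒟 grad (R.x t ω) := by
  unfold objGrad honestMean
  have : Measurable fun ω => ∑ i ∈ G, localGrad 𝒟 grad i (R.x t ω) :=
    Finset.measurable_sum _ fun i hi => hR.measurable_localGrad_x h hK hKc hx₁ hi ht htT
  exact this.const_smul (G.card : ℝ)⁻¹

variable [IsProbabilityMeasure P]

include hD

theorem IsSyncRun.lintegral_worker_error_le {i : Fin m} (hi : i ∈ G) {t : ℕ} (ht : 1 ≤ t)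
    (htT : t ≤ T) :
    ∫⁻ ω, ‖R.msg t i ω - localGrad 𝒟 grad i (R.x t ω)‖ₑ ^ 2 ∂P
      ≤ ENNReal.ofReal ((2 * σ ^ 2 + 8 * D ^ 2 * σL ^ 2) / t) := by
  classical
  have ht0 : (0 : ℝ) < t := by exact_mod_cast ht
  -- All weight on worker `i`, with `1/t` undoing the scaling.
  have := hR.lintegral_momentum_le h hK hKc hx₁ hD
    (fun j : G => if j = ⟨i, hi⟩ then (1 / t : ℝ) else 0) ht htT
  simp only [ite_smul, zero_smul, Finset.sum_ite_eq', Finset.mem_univ, if_true, smul_smul,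
    one_div_mul_cancel ht0.ne', one_smul, ite_pow, ne_eq, OfNat.ofNat_ne_zero, not_false_eq_true,
    zero_pow, ite_mul, zero_mul] at this
  refine this.trans (ENNReal.ofReal_le_ofReal (le_of_eq ?_))
  field_simp

theorem IsSyncRun.lintegral_mean_error_le (hG : 0 < G.card) {t : ℕ} (ht : 1 ≤ t) (htT : t ≤ T) :
    ∫⁻ ω, ‖honestMean G (fun i => R.msg t i ω) - objGrad G 𝒟 grad (R.x t ω)‖ₑ ^ 2 ∂P
      ≤ ENNReal.ofReal ((2 * σ ^ 2 + 8 * D ^ 2 * σL ^ 2) / (t * G.card)) := by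
  have ht0 : (0 : ℝ) < t := by exact_mod_cast ht
  have hc0 : (0 : ℝ) < G.card := by exact_mod_cast hG
  -- Equal weights `1/(|G| t)`: their squares sum to `1/(|G| t²)`, which is the variance reduction
  -- from averaging.
  have := hR.lintegral_momentum_le h hK hKc hx₁ hD (fun _ => (G.card : ℝ)⁻¹ * (t : ℝ)⁻¹) ht htT
  simp only [smul_smul, mul_assoc, inv_mul_cancel₀ ht0.ne', mul_one] at this
  refine le_trans (le_of_eq (lintegral_congr fun ω => ?_))
    (this.trans (ENNReal.ofReal_le_ofReal (le_of_eq ?_)))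
  · rw [objGrad, honestMean_sub, honestMean, ← Finset.smul_sum,
      Finset.sum_coe_sort G (fun i => R.msg t i ω - localGrad 𝒟 grad i (R.x t ω))]
  · simp only [Finset.sum_const, Finset.card_univ, Fintype.card_coe, nsmul_eq_mul]
    field_simp

theorem IsSyncRun.lintegral_agg_error_le [IsMarkovKernel A] (hA : IsRobust A c δ) (hc : 0 ≤ c)
    (hGδ : (1 - δ) * (m : ℝ) ≤ (G.card : ℝ)) (hG : 0 < G.card) {t : ℕ} (ht : 1 ≤ t)
    (htT : t ≤ T) :
    ∫⁻ ω, ‖R.agg t ω - honestMean G (fun i => R.msg t i ω)‖ₑ ^ 2 ∂P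
      ≤ ENNReal.ofReal (c * (2 * ((2 * σ ^ 2 + 8 * D ^ 2 * σL ^ 2) / t) + 2 * ξ ^ 2)) := by
  have hc0 : (0 : ℝ) < G.card := by exact_mod_cast hG
  have hF : Measurable fun p : (Fin m → Vec d) × Vec d => ‖p.2 - honestMean G p.1‖ₑ ^ 2 :=
    (measurable_snd.sub ((measurable_honestMean G).comp measurable_fst)).enorm.pow_const 2
  have hmsg : Measurable[R.info t] fun ω i => R.msg t i ω :=
    @measurable_pi_lambda _ _ _ (R.info t) _ _ fun i => hR.measurable_msg t ht htT i
  have hagg : Measurable (R.agg t) := (hR.measurable_agg t ht htT).mono (hR.hist_le _) le_rfl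
  rw [(hR.agg_law t ht htT).lintegral_eq (hR.info_le t) hagg hmsg hF]
  -- Bound for fixed messages: robustness, then the mean replaced by `∇f(x t)` as centre, then a
  -- split into worker errors and heterogeneity.
  have hpt : ∀ ω, ∫⁻ y, ‖y - honestMean G (fun i => R.msg t i ω)‖ₑ ^ 2 ∂(A fun i => R.msg t i ω)
      ≤ ENNReal.ofReal (2 * c * (G.card : ℝ)⁻¹)
          * ∑ i ∈ G, ‖R.msg t i ω - localGrad 𝒟 grad i (R.x t ω)‖ₑ ^ 2
        + ENNReal.ofReal (2 * c * ξ ^ 2) := fun ω => by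
    refine (hA.lintegral_le hGδ _).trans ?_
    have hx := hR.x_mem hKc hx₁ ht (by omega : t ≤ T + 1) ω
    simp_rw [enorm_sq_eq_ofReal]
    rw [← ENNReal.ofReal_sum_of_nonneg fun i _ => by positivity,
      ← ENNReal.ofReal_mul (by positivity), ← ENNReal.ofReal_add (by positivity) (by positivity)]
    refine ENNReal.ofReal_le_ofReal ?_
    have h1 := sum_norm_sub_honestMean_sq_le hG (fun i => R.msg t i ω)
      (objGrad G 𝒟 grad (R.x t ω))
    have h2 : ∑ i ∈ G, ‖R.msg t i ω - objGrad G 𝒟 grad (R.x t ω)‖ ^ 2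
        ≤ 2 * ∑ i ∈ G, ‖R.msg t i ω - localGrad 𝒟 grad i (R.x t ω)‖ ^ 2
          + 2 * ∑ i ∈ G, ‖localGrad 𝒟 grad i (R.x t ω) - objGrad G 𝒟 grad (R.x t ω)‖ ^ 2 := by
      rw [Finset.mul_sum, Finset.mul_sum, ← Finset.sum_add_distrib]
      refine Finset.sum_le_sum fun i _ => ?_
      have h3 := norm_sub_le_norm_sub_add_norm_sub (R.msg t i ω) (localGrad 𝒟 grad i (R.x t ω))
        (objGrad G 𝒟 grad (R.x t ω))
      have h4 := pow_le_pow_left₀ (norm_nonneg _) h3 2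
      nlinarith [sq_nonneg (‖R.msg t i ω - localGrad 𝒟 grad i (R.x t ω)‖
        - ‖localGrad 𝒟 grad i (R.x t ω) - objGrad G 𝒟 grad (R.x t ω)‖)]
    have h5 := mul_le_mul_of_nonneg_left (h1.trans h2) (by positivity : 0 ≤ c * (G.card : ℝ)⁻¹)
    have h6 := mul_le_mul_of_nonneg_left (h.heterogeneity _ hx) (by positivity : 0 ≤ 2 * c)
    linarith
  refine (lintegral_mono hpt).trans ?_
  have hm : ∀ i ∈ G, Measurable fun ω =>
      ‖R.msg t i ω - localGrad 𝒟 grad i (R.x t ω)‖ₑ ^ 2 := fun i hi =>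
    ((((hR.measurable_msg t ht htT i).mono (hR.info_le t) le_rfl).sub
      (hR.measurable_localGrad_x h hK hKc hx₁ hi ht htT)).enorm).pow_const 2
  rw [lintegral_add_right _ measurable_const, lintegral_const_mul' _ _ ENNReal.ofReal_ne_top,
    lintegral_finsetSum _ hm, lintegral_const, measure_univ, mul_one]
  have hsum : ∑ i ∈ G, ∫⁻ ω, ‖R.msg t i ω - localGrad 𝒟 grad i (R.x t ω)‖ₑ ^ 2 ∂P
      ≤ ENNReal.ofReal (G.card * ((2 * σ ^ 2 + 8 * D ^ 2 * σL ^ 2) / t)) := by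
    refine (Finset.sum_le_sum fun i hi =>
      hR.lintegral_worker_error_le h hK hKc hx₁ hD hi ht htT).trans (le_of_eq ?_)
    rw [Finset.sum_const, nsmul_eq_mul, ENNReal.ofReal_mul (Nat.cast_nonneg _),
      ENNReal.ofReal_natCast]
  refine (add_le_add_left (mul_le_mul_right hsum _) _).trans ?_
  rw [← ENNReal.ofReal_mul (by positivity), ← ENNReal.ofReal_add (by positivity) (by positivity)]
  refine ENNReal.ofReal_le_ofReal (le_of_eq ?_)
  field_simp

/-- The gradient error of the server in round `t`. -/
theorem IsSyncRun.integral_error_le [IsMarkovKernel A] (hA : IsRobust A c δ) (hc : 0 ≤ c)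
    (hξ : 0 ≤ ξ) (hGδ : (1 - δ) * (m : ℝ) ≤ (G.card : ℝ)) (hδ : δ < 1 / 2) (hm : 0 < m)
    {t : ℕ} (ht : 1 ≤ t) (htT : t ≤ T) :
    Integrable (fun ω => R.agg t ω - objGrad G 𝒟 grad (R.x t ω)) P ∧
    ∫ ω, ‖R.agg t ω - objGrad G 𝒟 grad (R.x t ω)‖ ∂P
      ≤ 2 * √(2 * σ ^ 2 + 8 * D ^ 2 * σL ^ 2) * √(c + 1 / m) / √t + 2 * √c * ξ := by
  have ht0 : (0 : ℝ) < t := by exact_mod_cast ht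
  have hm0 : (0 : ℝ) < m := by exact_mod_cast hm
  -- An honest majority turns `1/|G|` into at most `2/m`.
  have hGm : (m : ℝ) / 2 ≤ G.card := by nlinarith
  have hc0 : (0 : ℝ) < G.card := by linarith
  have hG : 0 < G.card := by exact_mod_cast hc0
  have hagg : Measurable (R.agg t) := (hR.measurable_agg t ht htT).mono (hR.hist_le _) le_rfl
  have hobj := hR.measurable_objGrad_x h hK hKc hx₁ ht htT
  have hmean : Measurable fun ω => honestMean G (fun i => R.msg t i ω) :=
    (measurable_honestMean G).comp (measurable_pi_lambda _ fun i =>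
      (hR.measurable_msg t ht htT i).mono (hR.info_le t) le_rfl)
  have herr : Measurable fun ω => R.agg t ω - objGrad G 𝒟 grad (R.x t ω) := hagg.sub hobj
  have hmerr : Measurable fun ω => honestMean G (fun i => R.msg t i ω)
      - objGrad G 𝒟 grad (R.x t ω) := hmean.sub hobj
  refine integral_norm_le_of_lintegral_le herr.aestronglyMeasurable (by positivity) ?_
  set B := 2 * σ ^ 2 + 8 * D ^ 2 * σL ^ 2
  have hB : 0 ≤ B := by positivity
  calc _ ≤ ∫⁻ ω, (2 * ‖R.agg t ω - honestMean G (fun i => R.msg t i ω)‖ₑ ^ 2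
        + 2 * ‖honestMean G (fun i => R.msg t i ω) - objGrad G 𝒟 grad (R.x t ω)‖ₑ ^ 2) ∂P := by
        refine lintegral_mono fun ω => ?_
        rw [← sub_add_sub_cancel (R.agg t ω) (honestMean G fun i => R.msg t i ω)
          (objGrad G 𝒟 grad (R.x t ω))]
        exact enorm_add_sq_le _ _
    _ = 2 * ∫⁻ ω, ‖R.agg t ω - honestMean G (fun i => R.msg t i ω)‖ₑ ^ 2 ∂P
        + 2 * ∫⁻ ω, ‖honestMean G (fun i => R.msg t i ω)
          - objGrad G 𝒟 grad (R.x t ω)‖ₑ ^ 2 ∂P := by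
        rw [lintegral_add_right _ ((hmerr.enorm.pow_const 2).const_mul 2),
          lintegral_const_mul' _ _ (by simp), lintegral_const_mul' _ _ (by simp)]
    _ ≤ 2 * ENNReal.ofReal (c * (2 * (B / t) + 2 * ξ ^ 2))
        + 2 * ENNReal.ofReal (B / (t * G.card)) := by
        gcongr
        · exact hR.lintegral_agg_error_le h hK hKc hx₁ hD hA hc hGδ hG ht htT
        · exact hR.lintegral_mean_error_le h hK hKc hx₁ hD hG ht htT
    _ ≤ _ := by
        rw [two_mul_ofReal, two_mul_ofReal, ← ENNReal.ofReal_add (by positivity) (by positivity)]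
        refine ENNReal.ofReal_le_ofReal ?_
        have e1 : (2 * √B * √(c + 1 / m) / √t) ^ 2 = 4 * B * (c + 1 / m) / t := by
          rw [div_pow, mul_pow, mul_pow, Real.sq_sqrt hB, Real.sq_sqrt (by positivity),
            Real.sq_sqrt ht0.le]
          ring
        have e2 : (2 * √c * ξ) ^ 2 = 4 * c * ξ ^ 2 := by
          rw [mul_pow, mul_pow, Real.sq_sqrt hc]; ring
        have e3 : 0 ≤ 2 * √B * √(c + 1 / m) / √t * (2 * √c * ξ) := by positivity
        have e4 : B / (t * G.card) ≤ B / (t * (m / 2)) := by gcongr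
        have e5 : 4 * B * (c + 1 / m) / t = 4 * c * (B / t) + 2 * (B / (t * (m / 2))) := by
          field_simp
          ring
        -- The claimed bound is squared and its nonnegative cross term `e3` dropped; the other two
        -- terms already cover the second moment.
        rw [add_sq, e1, e2, e5]
        linarith

theorem IsSyncRun.integral_suboptimality_le [IsMarkovKernel A] (hA : IsRobust A c δ) (hc : 0 ≤ c)
    (hξ : 0 ≤ ξ) (hGδ : (1 - δ) * (m : ℝ) ≤ (G.card : ℝ)) (hδ : δ < 1 / 2) (hm : 0 < m)
    (hL : 0 ≤ L) (hη : 0 < η) (hT : 1 ≤ T) (hf : ConvexOn ℝ K (objective G 𝒟 loss))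
    {u : Vec d} (hu : u ∈ K) :
    Integrable (fun ω => objective G 𝒟 loss (R.x T ω) - objective G 𝒟 loss u) P ∧
    (T * (T + 1) / 2 : ℝ) * ∫ ω, (objective G 𝒟 loss (R.x T ω) - objective G 𝒟 loss u) ∂P
      ≤ ‖objGrad G 𝒟 grad u‖ * D + D ^ 2 / η + 2 * L * D ^ 2 * T
        + D * (4 * √(2 * σ ^ 2 + 8 * D ^ 2 * σL ^ 2) * √(c + 1 / m) * √T * T
          + 4 * √c * ξ * T ^ 2) := by
  obtain ⟨π, hπ, hπK, hπid, hproj⟩ := exists_continuous_proj hK hKc ⟨x₁, hx₁⟩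
  have hm0 : (0 : ℝ) < m := by exact_mod_cast hm
  have hc0 : (0 : ℝ) < G.card := by nlinarith
  have hG : 0 < G.card := by exact_mod_cast hc0
  have hD0 : 0 ≤ D := (norm_nonneg _).trans (hD _ hx₁ _ hx₁)
  have hT0 : (0 : ℝ) < T := by exact_mod_cast hT
  have hgrad : ∀ x ∈ K, HasGradientWithinAt (objective G 𝒟 loss) (objGrad G 𝒟 grad x) K x :=
    fun x hx => h.hasGradientWithinAt_objective hKc hL hx
  have hcont : ContinuousOn (objective G 𝒟 loss) K := fun x hx =>
    (hgrad x hx).hasFDerivWithinAt.continuousWithinAt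
  have hint : Integrable (fun ω => objective G 𝒟 loss (R.x T ω) - objective G 𝒟 loss u) P := by
    have hxK := fun ω => hR.x_mem hKc hx₁ hT (by omega : T ≤ T + 1) ω
    have hmeas : Measurable fun ω => objective G 𝒟 loss (R.x T ω) := by
      have e : (fun ω => objective G 𝒟 loss (R.x T ω))
          = fun ω => objective G 𝒟 loss (π (R.x T ω)) := funext fun ω => by rw [hπid _ (hxK ω)]
      rw [e]
      exact (hcont.comp_continuous hπ hπK).measurable.comp
        ((hR.measurable_x hπ hproj hT (by omega)).mono (hR.hist_le T) le_rfl)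
    obtain ⟨M, hM⟩ := hK.exists_bound_of_continuousOn hcont
    exact (Integrable.of_bound hmeas.aestronglyMeasurable M
      (.of_forall fun ω => hM _ (hxK ω))).sub (integrable_const _)
  refine ⟨hint, ?_⟩
  -- Only rounds before `T` influence `x T`.
  have herr := fun t (ht : t ∈ Finset.Ico 1 T) =>
    hR.integral_error_le h hK hKc hx₁ hD hA hc hξ hGδ hδ hm (Finset.mem_Ico.1 ht).1
      (Finset.mem_Ico.1 ht).2.le
  have hq := fun x hx y hy => abs_sub_sub_inner_le hKc hL hgrad
    (fun x hx y hy => h.norm_objGrad_sub_le hG hx hy) (x := x) (y := y) hx hy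
  have hdet : ∀ ω, (T * (T + 1) / 2 : ℝ) * (objective G 𝒟 loss (R.x T ω) - objective G 𝒟 loss u)
      ≤ ‖objGrad G 𝒟 grad u‖ * D + D ^ 2 / η + 2 * L * D ^ 2 * T
        + ∑ t ∈ Finset.Ico 1 T, ((t : ℝ) + 1)
          * (D * ‖R.agg t ω - objGrad G 𝒟 grad (R.x t ω)‖) := fun ω => by
    have h1 := weighted_average_bound hf hL hq hD hη (T := T) (w := fun t => R.w t ω)
      (x := fun t => R.x t ω) (a := fun t => R.agg t ω) (hR.w_one ω)
      (hR.x_mem hKc hx₁ le_rfl (by omega) ω)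
      (fun t ht htT => hR.x_mem hKc hx₁ ht (by omega) ω)
      (fun t ht htT => hR.w_succ t ht htT ω) (fun t ht htT => hR.x_rec ht htT.le ω) hu hT le_rfl
    have h2 : 0 ≤ (1 + 1 / (T : ℝ)) / (2 * η) * ‖R.w T ω - u‖ ^ 2 := by positivity
    linarith
  have hei : ∀ t ∈ Finset.Ico 1 T, Integrable (fun ω => ((t : ℝ) + 1)
      * (D * ‖R.agg t ω - objGrad G 𝒟 grad (R.x t ω)‖)) P := fun t ht =>
    ((herr t ht).1.norm.const_mul D).const_mul _
  rw [← integral_const_mul]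
  have hsum : Integrable (fun ω => ‖objGrad G 𝒟 grad u‖ * D + D ^ 2 / η + 2 * L * D ^ 2 * T
      + ∑ t ∈ Finset.Ico 1 T, ((t : ℝ) + 1)
        * (D * ‖R.agg t ω - objGrad G 𝒟 grad (R.x t ω)‖)) P :=
    (integrable_const _).add (integrable_finsetSum _ hei)
  refine (integral_mono (hint.const_mul _) hsum hdet).trans ?_
  rw [integral_add (integrable_const _) (integrable_finsetSum _ hei), integral_finsetSum _ hei]
  simp only [integral_const, probReal_univ, one_smul, integral_const_mul]
  refine add_le_add_right ?_ _
  set B := 2 * σ ^ 2 + 8 * D ^ 2 * σL ^ 2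
  -- Uses `t + 1 ≤ 2t` and `t / √t = √t ≤ √T`, so each of the at most `T` terms has the same bound.
  have hterm : ∀ t ∈ Finset.Ico 1 T, ((t : ℝ) + 1)
      * (D * ∫ ω, ‖R.agg t ω - objGrad G 𝒟 grad (R.x t ω)‖ ∂P)
      ≤ D * (4 * √B * √(c + 1 / m) * √T + 4 * √c * ξ * T) := fun t ht => by
    have ht1 := (Finset.mem_Ico.1 ht).1
    have htT : (t : ℝ) ≤ T := by exact_mod_cast (Finset.mem_Ico.1 ht).2.le
    have ht1' : (1 : ℝ) ≤ t := by exact_mod_cast ht1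
    have hst : √(t : ℝ) ≤ √T := Real.sqrt_le_sqrt htT
    calc _ ≤ (2 * t : ℝ) * (D * (2 * √B * √(c + 1 / m) / √t + 2 * √c * ξ)) := by
          gcongr
          · linarith
          · exact (herr t ht).2
      _ = D * (4 * √B * √(c + 1 / m) * (t / √t) + 4 * √c * ξ * t) := by ring
      _ ≤ _ := by
          rw [Real.div_sqrt]
          gcongr
  refine (Finset.sum_le_sum hterm).trans ?_
  rw [Finset.sum_const, nsmul_eq_mul, Nat.card_Ico]
  have hcard : ((T - 1 : ℕ) : ℝ) ≤ T := by exact_mod_cast Nat.sub_le T 1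
  refine (mul_le_mul_of_nonneg_right hcard (by positivity)).trans (le_of_eq ?_)
  ring

end Run

/-! ### Final rates and the absolute constant. -/

theorem suboptimality_arith {T S g D η L E V X : ℝ} (hT : 1 ≤ T) (hS : T * (T + 1) / 2 * S
      ≤ g * D + D ^ 2 / η + 2 * L * D ^ 2 * T + D * (4 * E * V * √T * T + 4 * X * T ^ 2))
    (hg : 0 ≤ g) (hD : 0 ≤ D) (hL : 0 < L) (hη : 0 < η) (hηL : η ≤ 1 / (4 * L * T))
    (hE : 0 ≤ E) (hV : 0 ≤ V) (hX : 0 ≤ X) :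
    S ≤ 12 * (D ^ 2 / (η * T ^ 2) + g * D / T + D * E / √T * V + X * D) ∧
    (η = 1 / (4 * L * T) → S ≤ 12 * ((g * D + L * D ^ 2) / T + D * E / √T * V + X * D)) := by
  have hT0 : 0 < T := by linarith
  have hLη : 4 * L * T ≤ 1 / η := by
    rw [le_div_iff₀ hη]
    rw [le_div_iff₀ (by positivity)] at hηL
    linarith
  have h1 : S ≤ 3 * (D ^ 2 / (η * T ^ 2)) + 2 * (g * D / T) + 8 * (D * E / √T * V)
      + 8 * (X * D) := by
    have hs : √T * √T = T := Real.mul_self_sqrt hT0.le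
    have hs0 : 0 < √T := Real.sqrt_pos.2 hT0
    have e1 : D ^ 2 / (η * T ^ 2) * T ^ 2 = D ^ 2 / η := by field_simp
    have e2 : g * D / T * T ^ 2 = g * D * T := by field_simp
    have e3 : D * E / √T * V * T ^ 2 = D * E * V * √T * T := by
      have : T ^ 2 = √T * √T * T := by rw [hs]; ring
      rw [this]
      field_simp
    -- The step-size restriction enters here: `4LT ≤ 1/η`.
    have hLD : 2 * L * D ^ 2 * T ≤ D ^ 2 / η / 2 := by
      have := mul_le_mul_of_nonneg_left hLη (sq_nonneg D)
      rw [mul_one_div] at this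
      linarith
    have hgD : g * D ≤ g * D * T := le_mul_of_one_le_right (by positivity) hT
    have p1 : 0 ≤ D ^ 2 / (η * T ^ 2) := by positivity
    have p2 : 0 ≤ g * D / T := by positivity
    have p3 : 0 ≤ D * E / √T * V := by positivity
    have p4 : 0 ≤ X * D := by positivity
    -- Arguing by contradiction makes `S` nonnegative, which is needed to replace `T(T+1)/2` by
    -- `T²/2`.
    by_contra! hc
    have hR0 : 0 ≤ 3 * (D ^ 2 / (η * T ^ 2)) + 2 * (g * D / T) + 8 * (D * E / √T * V)
      + 8 * (X * D) := by positivity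
    have h5 : T ^ 2 / 2 * S ≤ T * (T + 1) / 2 * S := by
      have : 0 ≤ T * S := mul_nonneg hT0.le (hR0.trans hc.le)
      linarith
    have h6 := mul_lt_mul_of_pos_left hc (by positivity : 0 < T ^ 2 / 2)
    have h7 : T ^ 2 / 2 * (3 * (D ^ 2 / (η * T ^ 2)) + 2 * (g * D / T) + 8 * (D * E / √T * V)
        + 8 * (X * D)) = 3 / 2 * (D ^ 2 / η) + g * D * T + 4 * (D * E * V * √T * T)
        + 4 * (X * D) * T ^ 2 := by
      rw [← e1, ← e2, ← e3]; ring
    linarith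
  have p1 : 0 ≤ D ^ 2 / (η * T ^ 2) := by positivity
  have p2 : 0 ≤ g * D / T := by positivity
  have p3 : 0 ≤ D * E / √T * V := by positivity
  have p4 : 0 ≤ X * D := by positivity
  refine ⟨by linarith, fun h => ?_⟩
  have e : D ^ 2 / (η * T ^ 2) = 4 * (L * D ^ 2 / T) := by rw [h]; field_simp
  rw [e] at h1
  rw [add_div]
  linarith

end ByzSGD

theorem theorem2 :
    -- `C` is an absolute constant
    ∃ C : ℝ, 0 < C ∧
    ∀ (d m T : ℕ) (_ : 0 < m) (_ : 1 ≤ T)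
      -- the domain
      (K : Set (ByzSGD.Vec d)) (D : ℝ) (_ : IsCompact K) (_ : Convex ℝ K)
      (_ : ∀ x ∈ K, ∀ y ∈ K, ‖x - y‖ ≤ D)
      -- the honest workers
      (G : Finset (Fin m)) (δ : ℝ) (_ : 0 ≤ δ) (_ : δ < 1 / 2)
      (_ : (1 - δ) * (m : ℝ) ≤ (G.card : ℝ))
      -- the losses
      (Z : Type*) [MeasurableSpace Z] (𝒟 : Fin m → Measure Z) [∀ i, IsProbabilityMeasure (𝒟 i)]
      (loss : Fin m → ByzSGD.Vec d → Z → ℝ) (grad : Fin m → ByzSGD.Vec d → Z → ByzSGD.Vec d)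
      (L σ σL ξ : ℝ) (_ : 0 < L) (_ : 0 ≤ σ) (_ : 0 ≤ σL) (_ : 0 ≤ ξ)
      (_ : ByzSGD.SmoothStochasticLosses K G 𝒟 loss grad L σ σL ξ)
      (_ : ConvexOn ℝ K (ByzSGD.objective G 𝒟 loss))
      (xstar : ByzSGD.Vec d) (_ : xstar ∈ K)
      (_ : IsMinOn (ByzSGD.objective G 𝒟 loss) K xstar)
      -- the robust aggregation rule
      (A : Kernel (Fin m → ByzSGD.Vec d) (ByzSGD.Vec d)) [IsMarkovKernel A]
      (c : ℝ) (_ : 0 ≤ c) (_ : ByzSGD.IsRobust A c δ)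
      -- the run of the algorithm with `α_t = t`, `β_t = 1 / t`
      (η : ℝ) (_ : 0 < η) (_ : η ≤ 1 / (4 * L * T))
      (Ω : Type*) [MeasurableSpace Ω] (P : Measure Ω) [IsProbabilityMeasure P]
      (x₁ : ByzSGD.Vec d) (_ : x₁ ∈ K) (R : ByzSGD.Run Ω Z d m)
      (_ : ByzSGD.IsSyncRun P K G 𝒟 grad A (fun t => (t : ℝ)) (fun t => 1 / (t : ℝ)) η T x₁ R),
      let f := ByzSGD.objective G 𝒟 loss
      let Gstar := ‖ByzSGD.objGrad G 𝒟 grad xstar‖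
      let sigmaTilde := √(2 * σ ^ 2 + 8 * D ^ 2 * σL ^ 2)
      Integrable (fun ω => f (R.x T ω) - f xstar) P ∧
      -- every admissible learning rate
      ∫ ω, (f (R.x T ω) - f xstar) ∂P
        ≤ C * (D ^ 2 / (η * T ^ 2) + Gstar * D / T
            + D * sigmaTilde / √T * √(c + 1 / m) + √c * D * ξ) ∧
      -- the optimal learning rate
      (η = 1 / (4 * L * T) →
        ∫ ω, (f (R.x T ω) - f xstar) ∂P
          ≤ C * ((Gstar * D + L * D ^ 2) / T
              + D * sigmaTilde / √T * √(c + 1 / m) + √c * D * ξ)) := by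
  -- The first bound needs only `8`; at `η = 1/(4LT)` the term `3 D²/(ηT²)` becomes `12 LD²/T`.
  refine ⟨12, by norm_num, ?_⟩
  intro d m T hm hT K D hK hKc hD G δ _ hδ hGδ Z _ 𝒟 _ loss grad L σ σL ξ hL _ _ hξ h hf
    xstar hxstar _ A _ c hc hA η hη hηL Ω _ P _ x₁ hx₁ R hR
  obtain ⟨hint, hle⟩ := hR.integral_suboptimality_le h hK hKc hx₁ hD hA hc hξ hGδ hδ hm hL.le hη
    hT hf hxstar
  have hD0 : 0 ≤ D := (norm_nonneg _).trans (hD _ hx₁ _ hx₁)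
  obtain ⟨h1, h2⟩ := ByzSGD.suboptimality_arith (E := √(2 * σ ^ 2 + 8 * D ^ 2 * σL ^ 2))
    (V := √(c + 1 / m)) (X := √c * ξ) (by exact_mod_cast hT)
    (hle.trans (le_of_eq (by ring))) (norm_nonneg _) hD0 hL hη hηL (Real.sqrt_nonneg _)
    (Real.sqrt_nonneg _) (by positivity)
  rw [mul_right_comm √c ξ D] at h1 h2
  exact ⟨hint, h1, h2⟩
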